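/- Let $b_\pm,\delta_\pm,c$ be real numbers with $b_\pm>0$, $b_\pm+\delta_\pm>0$ and $c>0$. For $n\in\mathbb Z$ put $b_n=b_+$ and $d_n=b_++\delta_+$ if $n\ge 0$; $b_n=b_-$ and $d_n=b_-+\delta_-$ if $n\le -1$; and $c_n=b_++\delta_+$ if $n\ge 0$, $c_{-1}=c$, $c_n=b_-+\delta_-$ if $n\le -2$. For $k\in\mathbb R$ let $\widehat H_{\mathrm I}(k)$ be the bounded operator on $\ell^2(\mathbb Z;\mathbb C^6)$ which maps $\mathbf u=(u_{j,n})_{1\le j\le 6,\,n\in\mathbb Z}$ to \begin{align*} (\widehat H_{\mathrm I}(k)\mathbf u)_{1,n}&=-b_nu_{4,n}-b_nu_{5,n}-c_{n-1}e^{-ik}u_{6,n-1},\\ (\widehat H_{\mathrm I}(k)\mathbf u)_{2,n}&=-b_nu_{4,n}-d_ne^{ik}u_{5,n}-b_nu_{6,n},\\ (\widehat H_{\mathrm I}(k)\mathbf u)_{3,n}&=-c_nu_{4,n+1}-b_nu_{5,n}-b_nu_{6,n},\\ (\widehat H_{\mathrm I}(k)\mathbf u)_{4,n}&=-b_nu_{1,n}-b_nu_{2,n}-c_{n-1}u_{3,n-1},\\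 (\widehat H_{\mathrm I}(k)\mathbf u)_{5,n}&=-b_nu_{1,n}-d_ne^{-ik}u_{2,n}-b_nu_{3,n},\\ (\widehat H_{\mathrm I}(k)\mathbf u)_{6,n}&=-c_ne^{ik}u_{1,n+1}-b_nu_{2,n}-b_nu_{3,n}. \end{align*} Suppose that $0$ is a two-fold eigenvalue of $\widehat H_{\mathrm I}(0)$, that is, $\dim\ker\widehat H_{\mathrm I}(0)=2$. Then there are a constant $E^{(1)}_{\mathrm I}>0$ and real functions $E_{\mathrm I,-}(k),E_{\mathrm I,+}(k)$ such that, for some $\eta>0$ and all sufficiently small $|k|$, the eigenvalues $E$ of $\widehat H_{\mathrm I}(k)$ with $|E|<\eta$ are exactly $E_{\mathrm I,-}(k)$ and $E_{\mathrm I,+}(k)$, these satisfy $E_{\mathrm I,-}(k)<E_{\mathrm I,+}(k)$ if $k\ne0$, and \[ E_{\mathrm I,\pm}(k)=\pm E^{(1)}_{\mathrm I}|k|+\mathcal O(k^2)\qquad(k\to0). \] Consequently $E_{\mathrm I,\pm}(0)=0$ and the energy curves cross non-tangentially at $k=0$: the curve equal to $E_{\mathrm I,+}$ for $k\ge0$ and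 to $E_{\mathrm I,-}$ for $k<0$ has derivative $E^{(1)}_{\mathrm I}$ at $0$, and the curve equal to $E_{\mathrm I,-}$ for $k\ge0$ and to $E_{\mathrm I,+}$ for $k<0$ has derivative $-E^{(1)}_{\mathrm I}$ at $0$. -/

import Mathlib

open Asymptotics Filter Topology
open scoped ENNReal

noncomputable section

/-- The real parameters `(b₊, b₋, δ₊, δ₋, c)` of two half-plane materials joined along an interface:
intracell hopping `b±`, intercell hopping `b± + δ±`, and hopping `c` across the interface. -/
structure HoppingParameters where
  bPlus : ℝ
  bMinus : ℝ
  deltaPlus : ℝ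
  deltaMinus : ℝ
  c : ℝ

namespace HoppingParameters

/-- All hopping coefficients are strictly positive. -/
structure Positive (p : HoppingParameters) : Prop where
  bPlus_pos : 0 < p.bPlus
  bMinus_pos : 0 < p.bMinus
  interPlus_pos : 0 < p.bPlus + p.deltaPlus
  interMinus_pos : 0 < p.bMinus + p.deltaMinus
  c_pos : 0 < p.c

/-- `a_{n,I}`. -/
def aI (p : HoppingParameters) (n : ℤ) : ℝ :=
  if 1 ≤ n then p.bPlus + p.deltaPlus else if n = 0 then p.c else p.bMinus + p.deltaMinus

/-- `b_{n,I}`. -/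
def bI (p : HoppingParameters) (n : ℤ) : ℝ := if 0 ≤ n then p.bPlus else p.bMinus

/-- `c_{n,I}`. -/
def cI (p : HoppingParameters) (n : ℤ) : ℝ := p.aI (n + 1)

/-- `d_{n,I}`. -/
def dI (p : HoppingParameters) (n : ℤ) : ℝ :=
  if 0 ≤ n then p.bPlus + p.deltaPlus else p.bMinus + p.deltaMinus

/-- A common bound for all the hopping coefficients. -/
def bound (p : HoppingParameters) : ℝ :=
  |p.bPlus| + |p.bMinus| + |p.bPlus + p.deltaPlus| + |p.bMinus + p.deltaMinus| + |p.c|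

theorem abs_aI_le (p : HoppingParameters) (n : ℤ) : |p.aI n| ≤ p.bound := by
  unfold aI bound
  have h1 := abs_nonneg p.bPlus
  have h2 := abs_nonneg p.bMinus
  have h3 := abs_nonneg (p.bPlus + p.deltaPlus)
  have h4 := abs_nonneg (p.bMinus + p.deltaMinus)
  have h5 := abs_nonneg p.c
  split_ifs <;> linarith

theorem abs_bI_le (p : HoppingParameters) (n : ℤ) : |p.bI n| ≤ p.bound := by
  unfold bI bound
  have h1 := abs_nonneg p.bPlus
  have h2 := abs_nonneg p.bMinus
  have h3 := abs_nonneg (p.bPlus + p.deltaPlus)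
  have h4 := abs_nonneg (p.bMinus + p.deltaMinus)
  have h5 := abs_nonneg p.c
  split_ifs <;> linarith

theorem abs_dI_le (p : HoppingParameters) (n : ℤ) : |p.dI n| ≤ p.bound := by
  unfold dI bound
  have h1 := abs_nonneg p.bPlus
  have h2 := abs_nonneg p.bMinus
  have h3 := abs_nonneg (p.bPlus + p.deltaPlus)
  have h4 := abs_nonneg (p.bMinus + p.deltaMinus)
  have h5 := abs_nonneg p.c
  split_ifs <;> linarith

theorem bound_nonneg (p : HoppingParameters) : 0 ≤ p.bound := by
  unfold bound
  positivity

end HoppingParameters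

/-- `ℓ²(ℤ; ℂ⁶)`. -/
abbrev EdgeSpace : Type := lp (fun _ : ℤ => EuclideanSpace ℂ (Fin 6)) 2

/-- The factor `e^{ik}`. -/
def phase (k : ℝ) : ℂ := Complex.exp (Complex.I * k)

theorem norm_phase (k : ℝ) : ‖phase k‖ = 1 := by
  rw [phase, mul_comm]
  exact Complex.norm_exp_ofReal_mul_I k

/-- The difference expression of the type-I edge Hamiltonian at quasi-momentum `k`. The coordinates
`0, …, 5` stand for the sites `1, …, 6` of the cell. -/
def hamActionI (p : HoppingParameters) (k : ℝ) (u : ℤ → EuclideanSpace ℂ (Fin 6)) (n : ℤ) :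
    EuclideanSpace ℂ (Fin 6) :=
  !₂[-(p.bI n : ℂ) * u n 3 - (p.bI n : ℂ) * u n 4 - (p.cI (n - 1) : ℂ) * phase (-k) * u (n - 1) 5,
     -(p.bI n : ℂ) * u n 3 - (p.dI n : ℂ) * phase k * u n 4 - (p.bI n : ℂ) * u n 5,
     -(p.cI n : ℂ) * u (n + 1) 3 - (p.bI n : ℂ) * u n 4 - (p.bI n : ℂ) * u n 5,
     -(p.bI n : ℂ) * u n 0 - (p.bI n : ℂ) * u n 1 - (p.cI (n - 1) : ℂ) * u (n - 1) 2,
     -(p.bI n : ℂ) * u n 0 - (p.dI n : ℂ) * phase (-k) * u n 1 - (p.bI n : ℂ) * u n 2,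
     -((p.cI n : ℂ) * phase k) * u (n + 1) 0 - (p.bI n : ℂ) * u n 1 - (p.bI n : ℂ) * u n 2]

theorem norm_three_terms_le {M S : ℝ} {x y z a b c : ℂ} {A B C : ℝ} (hx : ‖x‖ ≤ M) (hy : ‖y‖ ≤ M)
    (hz : ‖z‖ ≤ M) (ha : ‖a‖ ≤ A) (hb : ‖b‖ ≤ B) (hc : ‖c‖ ≤ C) (hS : A + B + C ≤ S) :
    ‖-x * a - y * b - z * c‖ ^ 2 ≤ (M * S) ^ 2 := by
  have hM : 0 ≤ M := (norm_nonneg x).trans hx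
  have h1 : ‖-x * a - y * b - z * c‖ ≤ M * A + M * B + M * C := by
    refine (norm_sub_le _ _).trans (add_le_add ((norm_sub_le _ _).trans (add_le_add ?_ ?_)) ?_)
    · rw [norm_mul, norm_neg]; exact mul_le_mul hx ha (norm_nonneg _) hM
    · rw [norm_mul]; exact mul_le_mul hy hb (norm_nonneg _) hM
    · rw [norm_mul]; exact mul_le_mul hz hc (norm_nonneg _) hM
  have h2 : M * A + M * B + M * C ≤ M * S := by nlinarith
  exact pow_le_pow_left₀ (norm_nonneg _) (h1.trans h2) 2

theorem norm_hamActionI_sq_le (p : HoppingParameters) (k : ℝ)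
    (u : ℤ → EuclideanSpace ℂ (Fin 6)) (n : ℤ) :
    ‖hamActionI p k u n‖ ^ 2 ≤
      162 * p.bound ^ 2 * (‖u (n - 1)‖ ^ 2 + ‖u n‖ ^ 2 + ‖u (n + 1)‖ ^ 2) := by
  set S : ℝ := 3 * (‖u (n - 1)‖ + ‖u n‖ + ‖u (n + 1)‖) with hS
  have e1 := norm_nonneg (u (n - 1))
  have e2 := norm_nonneg (u n)
  have e3 := norm_nonneg (u (n + 1))
  have hb : ‖(p.bI n : ℂ)‖ ≤ p.bound := by simpa using p.abs_bI_le n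
  have hc : ‖(p.cI n : ℂ)‖ ≤ p.bound := by
    rw [Complex.norm_real, Real.norm_eq_abs]
    exact p.abs_aI_le (n + 1)
  have hc' : ‖(p.cI (n - 1) : ℂ)‖ ≤ p.bound := by
    rw [Complex.norm_real, Real.norm_eq_abs]
    exact p.abs_aI_le (n - 1 + 1)
  have hd : ‖(p.dI n : ℂ)‖ ≤ p.bound := by simpa using p.abs_dI_le n
  have hph : ∀ (z : ℂ) (q : ℝ), ‖z‖ ≤ p.bound → ‖z * phase q‖ ≤ p.bound := by
    intro z q hz; rwa [norm_mul, norm_phase, mul_one]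
  have hu : ∀ m j, ‖u m j‖ ≤ ‖u m‖ := fun m j => PiLp.norm_apply_le (u m) j
  have g0 : ‖hamActionI p k u n 0‖ ^ 2 ≤ (p.bound * S) ^ 2 :=
    norm_three_terms_le hb hb (hph _ _ hc') (hu _ _) (hu _ _) (hu _ _) (by linarith)
  have g1 : ‖hamActionI p k u n 1‖ ^ 2 ≤ (p.bound * S) ^ 2 :=
    norm_three_terms_le hb (hph _ _ hd) hb (hu _ _) (hu _ _) (hu _ _) (by linarith)
  have g2 : ‖hamActionI p k u n 2‖ ^ 2 ≤ (p.bound * S) ^ 2 :=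
    norm_three_terms_le hc hb hb (hu _ _) (hu _ _) (hu _ _) (by linarith)
  have g3 : ‖hamActionI p k u n 3‖ ^ 2 ≤ (p.bound * S) ^ 2 :=
    norm_three_terms_le hb hb hc' (hu _ _) (hu _ _) (hu _ _) (by linarith)
  have g4 : ‖hamActionI p k u n 4‖ ^ 2 ≤ (p.bound * S) ^ 2 :=
    norm_three_terms_le hb (hph _ _ hd) hb (hu _ _) (hu _ _) (hu _ _) (by linarith)
  have g5 : ‖hamActionI p k u n 5‖ ^ 2 ≤ (p.bound * S) ^ 2 :=
    norm_three_terms_le (hph _ _ hc) hb hb (hu _ _) (hu _ _) (hu _ _) (by linarith)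
  have key : ‖hamActionI p k u n‖ ^ 2 ≤ 6 * (p.bound * S) ^ 2 := by
    rw [EuclideanSpace.norm_sq_eq, Fin.sum_univ_six]
    linarith
  have hS2 : S ^ 2 ≤ 27 * (‖u (n - 1)‖ ^ 2 + ‖u n‖ ^ 2 + ‖u (n + 1)‖ ^ 2) := by
    rw [hS]
    nlinarith [sq_nonneg (‖u (n - 1)‖ - ‖u n‖), sq_nonneg (‖u (n - 1)‖ - ‖u (n + 1)‖),
      sq_nonneg (‖u n‖ - ‖u (n + 1)‖)]
  have := mul_le_mul_of_nonneg_left hS2 (by positivity : 0 ≤ 6 * p.bound ^ 2)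
  rw [mul_pow] at key
  linarith

theorem hasSum_norm_sq (u : EdgeSpace) : HasSum (fun n : ℤ => ‖u n‖ ^ 2) (‖u‖ ^ 2) := by
  simpa using lp.hasSum_norm (p := 2) (by norm_num) u

theorem hasSum_three_shifts {f : ℤ → ℝ} {a : ℝ} (h : HasSum f a) :
    HasSum (fun n : ℤ => f (n - 1) + f n + f (n + 1)) (3 * a) := by
  have h1 : HasSum (fun n : ℤ => f (n - 1)) a := (Equiv.subRight (1 : ℤ)).hasSum_iff.mpr h
  have h2 : HasSum (fun n : ℤ => f (n + 1)) a := (Equiv.addRight (1 : ℤ)).hasSum_iff.mpr h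
  have h3 := (h1.add h).add h2
  rwa [show a + a + a = 3 * a by ring] at h3

theorem hasSum_norm_sq_shifts (u : EdgeSpace) :
    HasSum (fun n : ℤ => ‖(u : ℤ → EuclideanSpace ℂ (Fin 6)) (n - 1)‖ ^ 2 +
      ‖(u : ℤ → EuclideanSpace ℂ (Fin 6)) n‖ ^ 2 +
      ‖(u : ℤ → EuclideanSpace ℂ (Fin 6)) (n + 1)‖ ^ 2) (3 * ‖u‖ ^ 2) := by
  have h := hasSum_three_shifts (hasSum_norm_sq u)
  exact h

theorem memℓp_hamActionI (p : HoppingParameters) (k : ℝ) (u : EdgeSpace) :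
    Memℓp (hamActionI p k u) 2 := by
  apply memℓp_gen
  have h := (hasSum_norm_sq_shifts u).summable.mul_left (162 * p.bound ^ 2)
  simpa using Summable.of_nonneg_of_le (fun n => sq_nonneg _)
    (fun n => norm_hamActionI_sq_le p k u n) h

/-- The type-I edge Hamiltonian as a linear map. -/
def hamLinI (p : HoppingParameters) (k : ℝ) : EdgeSpace →ₗ[ℂ] EdgeSpace where
  toFun u := ⟨hamActionI p k u, memℓp_hamActionI p k u⟩
  map_add' u v := by
    apply Subtype.ext
    funext n
    change hamActionI p k (⇑(u + v)) n = hamActionI p k u n + hamActionI p k v n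
    ext j
    fin_cases j <;> simp [hamActionI] <;> ring
  map_smul' a u := by
    apply Subtype.ext
    funext n
    change hamActionI p k (⇑(a • u)) n = a • hamActionI p k u n
    ext j
    fin_cases j <;> simp [hamActionI] <;> ring

theorem norm_hamLinI_le (p : HoppingParameters) (k : ℝ) (u : EdgeSpace) :
    ‖hamLinI p k u‖ ≤ 27 * p.bound * ‖u‖ := by
  have h := hasSum_le (fun n => norm_hamActionI_sq_le p k u n) (hasSum_norm_sq (hamLinI p k u))
    ((hasSum_norm_sq_shifts u).mul_left (162 * p.bound ^ 2))
  have hb := p.bound_nonneg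
  refine abs_le_of_sq_le_sq' ?_ (by positivity) |>.2
  nlinarith [mul_nonneg (sq_nonneg p.bound) (sq_nonneg ‖u‖)]

/-- The type-I edge Hamiltonian `Ĥ_I(k)`, a bounded operator on `ℓ²(ℤ; ℂ⁶)`. -/
def hamiltonianI (p : HoppingParameters) (k : ℝ) : EdgeSpace →L[ℂ] EdgeSpace :=
  (hamLinI p k).mkContinuous (27 * p.bound) (norm_hamLinI_le p k)

theorem hamiltonianI_apply (p : HoppingParameters) (k : ℝ) (u : EdgeSpace) (n : ℤ) :
    hamiltonianI p k u n = hamActionI p k u n := rfl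

end

/-!
The Hamiltonian is off-diagonal for the splitting of the sites into the sublattices `0`, `1`, `2`
and `3`, `4`, `5` (counted from zero), and at `k = 0` it commutes with the exchange of the two. A
kernel of dimension two is therefore spanned by a unit vector `φ` on the first sublattice and its
mirror image `ψ` on the second. The derivative `H₁` at `k = 0` is off-diagonal as well, so its
compression to the kernel is off-diagonal in the basis `φ`, `ψ`, with eigenvalues `± |⟪ψ, H₁ φ⟫|`.
These are the slopes. They do not vanish: pairing the zero-mode equations with `φ` and summing over
the cells shows that `2 Im ⟪ψ, H₁ φ⟫` is a weighted sum of the `|φ|²` with positive weights.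

Zero is isolated in the spectrum at `k = 0`. If `δ₊ ≠ 0` and `δ₋ ≠ 0`, the adjugate of the bulk
symbol turns `H u` into a subsolution inequality for `‖u n‖`, which bounds `‖u‖` by `‖H u‖` and the
values of `u` next to the interface. If `δ₊ = 0` or `δ₋ = 0`, a zero mode is constant along one ray,
hence zero, and the kernel is trivial.

With a gap on the orthogonal complement of the kernel, a kernel eigenvector of the compression of
`H₁`, corrected to first order in `k`, is a quasimode with error `O(k²)`, which by self-adjointness
lies within `O(k²)` of an eigenvalue. Counting dimensions, there are no further eigenvalues near
zero.
-/

section BoundedBelow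

variable {𝕜 : Type*} [NontriviallyNormedField 𝕜] [CompleteSpace 𝕜]
  {E F W : Type*} [NormedAddCommGroup E] [NormedSpace 𝕜 E] [CompleteSpace E]
  [NormedAddCommGroup F] [NormedSpace 𝕜 F] [CompleteSpace F]
  [NormedAddCommGroup W] [NormedSpace 𝕜 W] [FiniteDimensional 𝕜 W]

open scoped LinearMap.FiniteRangeSetoid in
theorem exists_mul_norm_le_of_injective_of_finiteDimensional {T : E →L[𝕜] F} {R : E →L[𝕜] W}
    {C : ℝ} (hC : ∀ u, ‖u‖ ≤ C * (‖T u‖ + ‖R u‖)) (hT : Function.Injective T) :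
    ∃ g : ℝ, 0 < g ∧ ∀ u, g * ‖u‖ ≤ ‖T u‖ := by
  have : CompleteSpace W := FiniteDimensional.complete 𝕜 W
  -- `(T, R)` is a closed embedding, and `(T, 0)` is a perturbation of it of finite rank.
  have hTR : AntilipschitzWith (2 * Real.nnabs C) (T.prod R) :=
    (T.prod R).antilipschitz_of_bound fun u => calc
      ‖u‖ ≤ |C| * (‖T u‖ + ‖R u‖) := (hC u).trans (by gcongr; exact le_abs_self C)
      _ ≤ |C| * (‖(T u, R u)‖ + ‖(T u, R u)‖) := by
          gcongr
          exacts [norm_fst_le (T u, R u), norm_snd_le (T u, R u)]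
      _ = (2 * Real.nnabs C : NNReal) * ‖T.prod R u‖ := by
          push_cast [Real.coe_nnabs, ContinuousLinearMap.prod_apply]
          ring
  have hfinite : (T.prod R).toLinearMap ≈ (T.prod (0 : E →L[𝕜] W)).toLinearMap := by
    have hsub : (T.prod R).toLinearMap - (T.prod (0 : E →L[𝕜] W)).toLinearMap =
        LinearMap.inr 𝕜 F W ∘ₗ R.toLinearMap := by
      ext u <;> simp
    rw [LinearMap.FiniteRangeSetoid.equiv_iff_hasFiniteRange, hsub]
    exact LinearMap.HasFiniteRange.of_finite_dom.comp_right R.toLinearMap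
  have hclosed : IsClosed (Set.range (T.prod (0 : E →L[𝕜] W))) :=
    ((T.prod R).isStrictMap_isClosed_range_iff_of_finiteRangeSetoid (T.prod 0) hfinite |>.mp
      ⟨(hTR.isEmbedding (T.prod R).continuous).isStrictMap,
        hTR.isClosed_range (T.prod R).uniformContinuous⟩).2
  obtain ⟨K, hK⟩ := (T.prod (0 : E →L[𝕜] W)).antilipschitz_of_injective_of_isClosed_range
    (fun u v h => hT (congrArg Prod.fst h)) hclosed
  refine ⟨(K + 1 : ℝ)⁻¹, by positivity, fun u => ?_⟩
  rw [inv_mul_le_iff₀ (by positivity)]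
  calc ‖u‖ ≤ K * ‖T.prod (0 : E →L[𝕜] W) u‖ := hK.le_mul_norm (map_zero _) u
    _ = K * ‖T u‖ := by simp [Prod.norm_def]
    _ ≤ (K + 1) * ‖T u‖ := by gcongr; linarith

end BoundedBelow

section FiniteCodimension

variable {𝕜 : Type*} [RCLike 𝕜] {X : Type*} [NormedAddCommGroup X] [InnerProductSpace 𝕜 X]

theorem exists_mul_norm_le_of_injective_of_orthogonal [CompleteSpace X] {F : Type*}
    [NormedAddCommGroup F] [NormedSpace 𝕜 F] [CompleteSpace F] {T : X →L[𝕜] F} {Y : Submodule 𝕜 X}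
    [FiniteDimensional 𝕜 Y] {c : ℝ} (hc : 0 < c) (hY : ∀ u ∈ Yᗮ, c * ‖u‖ ≤ ‖T u‖)
    (hT : Function.Injective T) : ∃ g : ℝ, 0 < g ∧ ∀ u, g * ‖u‖ ≤ ‖T u‖ := by
  refine exists_mul_norm_le_of_injective_of_finiteDimensional
    (R := Y.orthogonalProjectionOnto) (C := c⁻¹ * (1 + ‖T‖) + 1) (fun u => ?_) hT
  set y : Y := Y.orthogonalProjectionOnto u
  have hTu : c * ‖u - y‖ ≤ ‖T u‖ + ‖T‖ * ‖y‖ := calc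
    c * ‖u - y‖ ≤ ‖T (u - y)‖ := hY _ (Y.sub_starProjection_mem_orthogonal u)
    _ ≤ ‖T u‖ + ‖T y‖ := by rw [map_sub]; exact norm_sub_le _ _
    _ ≤ ‖T u‖ + ‖T‖ * ‖y‖ := by gcongr; exact T.le_opNorm y
  calc ‖u‖ ≤ ‖u - y‖ + ‖y‖ := norm_le_norm_sub_add u y
    _ ≤ c⁻¹ * (‖T u‖ + ‖T‖ * ‖y‖) + ‖y‖ := by gcongr; rwa [le_inv_mul_iff₀ hc]
    _ ≤ c⁻¹ * ((1 + ‖T‖) * (‖T u‖ + ‖y‖)) + (‖T u‖ + ‖y‖) := by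
        gcongr
        · nlinarith [norm_nonneg (T u), norm_nonneg y, norm_nonneg T]
        · exact le_add_of_nonneg_left (norm_nonneg _)
    _ = (c⁻¹ * (1 + ‖T‖) + 1) * (‖T u‖ + ‖y‖) := by ring

variable {ι : Type*}

theorem exists_orthonormal_eigenvectors {T : X →ₗ[𝕜] X} (hT : T.IsSymmetric) {E : ι → 𝕜}
    (hE : Function.Injective E) (hev : ∀ i, Module.End.HasEigenvalue T (E i)) :
    ∃ v : ι → X, Orthonormal 𝕜 v ∧ ∀ i, T (v i) = E i • v i := by
  choose w hw using fun i => (hev i).exists_hasEigenvector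
  have hortho (i j : ι) (hij : i ≠ j) : inner 𝕜 (w i) (w j) = 0 :=
    hT.orthogonalFamily_eigenspaces (hE.ne hij) ⟨w i, (hw i).1⟩ ⟨w j, (hw j).1⟩
  refine ⟨fun i => ((‖w i‖ : 𝕜)⁻¹) • w i, ⟨fun i => ?_, fun i j hij => ?_⟩, fun i => ?_⟩
  · exact norm_smul_inv_norm (hw i).2
  · simp [inner_smul_left, inner_smul_right, hortho i j hij]
  · rw [map_smul, (hw i).apply_eq_smul, smul_comm]

theorem card_eigenvalues_le_finrank [Fintype ι] {T : X →ₗ[𝕜] X} (hT : T.IsSymmetric)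
    {Y : Submodule 𝕜 X} [FiniteDimensional 𝕜 Y] {γ : ℝ} (hγ : ∀ u ∈ Yᗮ, γ * ‖u‖ ≤ ‖T u‖)
    {E : ι → 𝕜} (hE : Function.Injective E) (hev : ∀ i, Module.End.HasEigenvalue T (E i))
    (hlt : ∀ i, ‖E i‖ < γ) : Fintype.card ι ≤ Module.finrank 𝕜 Y := by
  obtain ⟨v, hv, hTv⟩ := exists_orthonormal_eigenvectors hT hE hev
  have hnorm (c : ι → 𝕜) : ‖∑ i, c i • v i‖ ^ 2 = ∑ i, ‖c i‖ ^ 2 := by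
    rw [← RCLike.ofReal_inj (K := 𝕜)]
    push_cast
    rw [← inner_self_eq_norm_sq_to_K, hv.inner_sum]
    simp [RCLike.conj_mul]
  -- Otherwise a combination of the eigenvectors is orthogonal to `Y`, where `T` is too large.
  by_contra! hcard
  let L : (ι → 𝕜) →ₗ[𝕜] Y :=
    Y.orthogonalProjectionOnto.toLinearMap ∘ₗ Fintype.linearCombination 𝕜 v
  obtain ⟨c, hcL, hc⟩ := Submodule.exists_mem_ne_zero_of_ne_bot
    (L.ker_ne_bot_of_finrank_lt (by simpa using hcard))
  have hmem : ∑ i, c i • v i ∈ Yᗮ := by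
    rw [← Submodule.orthogonalProjectionOnto_eq_zero_iff]
    simpa [L, Fintype.linearCombination_apply] using hcL
  obtain ⟨j, hj⟩ := Function.ne_iff.mp hc
  have hγ0 : 0 < γ := (norm_nonneg _).trans_lt (hlt j)
  have hlarge := pow_le_pow_left₀ (by positivity) (hγ _ hmem) 2
  have hsmall : ∑ i, ‖c i * E i‖ ^ 2 < ∑ i, γ ^ 2 * ‖c i‖ ^ 2 := by
    have hterm (i : ι) : ‖c i * E i‖ ^ 2 ≤ γ ^ 2 * ‖c i‖ ^ 2 := by
      rw [norm_mul, mul_pow, mul_comm]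
      gcongr
      exact (hlt i).le
    refine Finset.sum_lt_sum (fun i _ => hterm i) ⟨j, Finset.mem_univ j, ?_⟩
    have : 0 < ‖c j‖ := norm_pos_iff.mpr hj
    rw [norm_mul, mul_pow, mul_comm]
    gcongr
    exact hlt j
  have himage : T (∑ i, c i • v i) = ∑ i, (c i * E i) • v i := by
    simp only [map_sum, map_smul, hTv, smul_smul]
  rw [himage, mul_pow, hnorm, hnorm, Finset.mul_sum] at hlarge
  exact hsmall.not_ge hlarge

theorem setOf_eigenvalues_eq_range [Fintype ι] {T : X →ₗ[𝕜] X} (hT : T.IsSymmetric)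
    {Y : Submodule 𝕜 X} [FiniteDimensional 𝕜 Y] (hY : Module.finrank 𝕜 Y = Fintype.card ι) {γ : ℝ}
    (hγ : ∀ u ∈ Yᗮ, γ * ‖u‖ ≤ ‖T u‖) {E : ι → 𝕜} (hE : Function.Injective E)
    (hev : ∀ i, Module.End.HasEigenvalue T (E i)) (hlt : ∀ i, ‖E i‖ < γ) :
    {z : 𝕜 | ‖z‖ < γ ∧ Module.End.HasEigenvalue T z} = Set.range E := by
  refine Set.Subset.antisymm (fun z hz => ?_) (Set.range_subset_iff.mpr fun i => ⟨hlt i, hev i⟩)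
  by_contra hz_not
  have hcard := card_eigenvalues_le_finrank hT hγ (E := fun o : Option ι => o.elim z E)
    (Option.injective_iff.mpr ⟨hE, hz_not⟩) (Option.forall.mpr ⟨hz.2, hev⟩)
    (Option.forall.mpr ⟨hz.1, hlt⟩)
  simp [hY] at hcard

end FiniteCodimension

section SelfAdjoint

variable {X : Type*} [NormedAddCommGroup X] [InnerProductSpace ℂ X] [CompleteSpace X]
  {T : X →L[ℂ] X}

theorem isUnit_of_isSelfAdjoint_of_mul_norm_le (hT : IsSelfAdjoint T) {g : ℝ} (hg : 0 < g)
    (h : ∀ u, g * ‖u‖ ≤ ‖T u‖) : IsUnit T := by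
  have hsq : IsUnit (T ^ 2) := by
    refine ContinuousLinearMap.isUnit_of_forall_le_norm_inner_map (T ^ 2)
      (c := (g ^ 2).toNNReal) (Real.toNNReal_pos.mpr (pow_pos hg 2)) fun u => ?_
    have hinner : inner ℂ ((T ^ 2) u) u = inner ℂ (T u) (T u) := by
      rw [pow_two]
      exact hT.isSymmetric (T u) u
    rw [hinner, inner_self_eq_norm_sq_to_K, Real.coe_toNNReal _ (sq_nonneg g), norm_pow,
      RCLike.norm_ofReal, abs_norm, ← mul_pow, mul_comm]
    exact pow_le_pow_left₀ (by positivity) (h u) 2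
  exact (isUnit_pow_iff two_ne_zero).mp hsq

theorem exists_mem_spectrum_norm_le (hT : IsSelfAdjoint T) {φ : X} (hφ : φ ≠ 0) {ε : ℝ}
    (h : ‖T φ‖ ≤ ε * ‖φ‖) : ∃ z ∈ spectrum ℂ T, ‖z‖ ≤ ε := by
  have hφ' : 0 < ‖φ‖ := norm_pos_iff.mpr hφ
  by_cases hunit : IsUnit T
  swap
  · exact ⟨0, spectrum.zero_mem ℂ hunit, by
      simpa using nonneg_of_mul_nonneg_left ((norm_nonneg _).trans h) hφ'⟩
  obtain ⟨U, rfl⟩ := hunit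
  have : Nontrivial X := ⟨φ, 0, hφ⟩
  have hinv : IsSelfAdjoint (↑U⁻¹ : X →L[ℂ] X) :=
    congrArg Units.val (IsSelfAdjoint.inv (Units.ext hT : IsSelfAdjoint U))
  obtain ⟨z, hz, hznorm⟩ := spectrum.exists_nnnorm_eq_spectralRadius (↑U⁻¹ : X →L[ℂ] X)
  rw [hinv.spectralRadius_eq_nnnorm, ENNReal.coe_inj] at hznorm
  have hnorm : ‖φ‖ ≤ ‖z‖ * (ε * ‖φ‖) := calc
    ‖φ‖ = ‖(↑U⁻¹ * U : X →L[ℂ] X) φ‖ := by rw [Units.inv_mul]; rfl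
    _ ≤ ‖(↑U⁻¹ : X →L[ℂ] X)‖ * ‖(U : X →L[ℂ] X) φ‖ := (↑U⁻¹ : X →L[ℂ] X).le_opNorm (U.val φ)
    _ = ‖z‖ * ‖(U : X →L[ℂ] X) φ‖ := by rw [← coe_nnnorm, ← hznorm, coe_nnnorm]
    _ ≤ ‖z‖ * (ε * ‖φ‖) := by gcongr
  have hone : 1 ≤ ‖z‖ * ε := le_of_mul_le_mul_right (by linarith) hφ'
  have hz0 : z ≠ 0 := by
    rintro rfl
    norm_num at hone
  refine ⟨z⁻¹, ?_, ?_⟩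
  · simpa using (spectrum.inv_mem_iff (r := (Units.mk0 z hz0)⁻¹) (a := U)).mpr (by simpa using hz)
  · rwa [norm_inv, inv_le_iff_one_le_mul₀' (norm_pos_iff.mpr hz0)]

theorem exists_mem_spectrum_norm_sub_le (hT : IsSelfAdjoint T) {φ : X} (hφ : φ ≠ 0) {μ ε : ℝ}
    (h : ‖T φ - (μ : ℂ) • φ‖ ≤ ε * ‖φ‖) : ∃ z ∈ spectrum ℂ T, ‖z - μ‖ ≤ ε := by
  have hshift : IsSelfAdjoint (T - algebraMap ℂ (X →L[ℂ] X) μ) :=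
    hT.sub (IsSelfAdjoint.algebraMap _ (Complex.conj_ofReal μ))
  have hφμ : ‖(T - algebraMap ℂ (X →L[ℂ] X) μ) φ‖ ≤ ε * ‖φ‖ := by
    rwa [Algebra.algebraMap_eq_smul_one]
  obtain ⟨z, hz, hzε⟩ := exists_mem_spectrum_norm_le hshift hφ hφμ
  refine ⟨z + μ, ?_, by rwa [add_sub_cancel_right]⟩
  rw [spectrum.mem_iff] at hz ⊢
  rwa [map_add, ← sub_sub_eq_add_sub]

theorem hasEigenvalue_of_mem_spectrum_of_norm_lt (hT : IsSelfAdjoint T) {Y : Submodule ℂ X}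
    [FiniteDimensional ℂ Y] {γ : ℝ} (hγ : ∀ u ∈ Yᗮ, γ * ‖u‖ ≤ ‖T u‖) {z : ℂ}
    (hz : z ∈ spectrum ℂ T) (hlt : ‖z‖ < γ) :
    Module.End.HasEigenvalue (T : X →ₗ[ℂ] X) z := by
  have hshift : IsSelfAdjoint (algebraMap ℂ (X →L[ℂ] X) z - T) := by
    refine (IsSelfAdjoint.algebraMap _ ?_).sub hT
    rw [hT.mem_spectrum_eq_re hz]
    exact Complex.conj_ofReal _
  set S : X →L[ℂ] X := algebraMap ℂ (X →L[ℂ] X) z - T with hS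
  have hSapply (u : X) : S u = z • u - T u := by
    simp [hS, Algebra.algebraMap_eq_smul_one]
  by_contra hz_not
  have hinj : Function.Injective S := by
    refine (injective_iff_map_eq_zero S).mpr fun u hu => ?_
    by_contra hu0
    rw [hSapply, sub_eq_zero] at hu
    exact hz_not (Module.End.hasEigenvalue_of_hasEigenvector
      ⟨Module.End.mem_eigenspace_iff.mpr hu.symm, hu0⟩)
  have hSY : ∀ u ∈ Yᗮ, (γ - ‖z‖) * ‖u‖ ≤ ‖S u‖ := fun u hu => calc
    (γ - ‖z‖) * ‖u‖ ≤ ‖T u‖ - ‖z • u‖ := by rw [sub_mul, norm_smul]; linarith [hγ u hu]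
    _ ≤ ‖S u‖ := by rw [hSapply, norm_sub_rev]; exact norm_sub_norm_le _ _
  obtain ⟨g, hg, hSg⟩ := exists_mul_norm_le_of_injective_of_orthogonal (sub_pos.mpr hlt) hSY hinj
  exact hz (isUnit_of_isSelfAdjoint_of_mul_norm_le hshift hg hSg)

theorem exists_apply_eq_of_mem_orthogonal_ker (hT : IsSelfAdjoint T) {γ : ℝ} (hγ : 0 < γ)
    (hgap : ∀ u ∈ T.kerᗮ, γ * ‖u‖ ≤ ‖T u‖) {v : X} (hv : v ∈ T.kerᗮ) : ∃ w, T w = v := by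
  have hanti : AntilipschitzWith (Real.toNNReal γ⁻¹) (T ∘L T.kerᗮ.subtypeL) :=
    ContinuousLinearMap.antilipschitz_of_bound _ fun u => by
      rw [Real.coe_toNNReal _ (by positivity), le_inv_mul_iff₀ hγ]
      exact hgap u u.2
  have hclosed := hanti.isClosed_range (T ∘L T.kerᗮ.subtypeL).uniformContinuous
  have hadjoint : T.rangeᗮ = T.ker := by rw [T.orthogonal_range, hT.adjoint_eq]
  have hclosure : v ∈ closure (T.range : Set X) := by
    rwa [← Submodule.topologicalClosure_coe, ← Submodule.orthogonal_orthogonal_eq_closure,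
      hadjoint]
  have hsubset : (T.range : Set X) ⊆ Set.range (T ∘L T.kerᗮ.subtypeL) := by
    rintro _ ⟨u, rfl⟩
    refine ⟨⟨u - T.ker.starProjection u, T.ker.sub_starProjection_mem_orthogonal u⟩, ?_⟩
    have hker : T (T.ker.starProjection u) = 0 := T.ker.starProjection_apply_mem u
    simp [hker]
  obtain ⟨w, hw⟩ := closure_minimal hsubset hclosed hclosure
  exact ⟨w, hw⟩

end SelfAdjoint

theorem apply_zero_of_isBigO_sq {f : ℝ → ℝ} {m : ℝ}
    (hf : (fun k => f k - m * k) =O[𝓝 0] fun k => k ^ 2) : f 0 = 0 := by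
  simpa using hf.eq_zero_imp.self_of_nhds

theorem hasDerivAt_zero_of_isBigO_sq {f : ℝ → ℝ} {m : ℝ}
    (hf : (fun k => f k - m * k) =O[𝓝 0] fun k => k ^ 2) : HasDerivAt f m 0 := by
  have hlittle : (fun k : ℝ => k ^ 2) =o[𝓝 0] fun k => k := by
    simpa using isLittleO_pow_pow (𝕜 := ℝ) one_lt_two
  rw [hasDerivAt_iff_isLittleO]
  simpa [apply_zero_of_isBigO_sq hf, mul_comm] using hf.trans_isLittleO hlittle

theorem eventually_injective_of_hasDerivAt {ι : Type*} [Finite ι] {f : ι → ℝ → ℝ} {f' : ι → ℝ}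
    {x : ℝ} (hf : ∀ i, HasDerivAt (f i) (f' i) x) (hf' : Function.Injective f') :
    ∀ᶠ k in 𝓝[≠] x, Function.Injective fun i => f i k := by
  have hne : ∀ᶠ k in 𝓝[≠] x, ∀ i j, i ≠ j → f i k ≠ f j k := by
    simp only [eventually_all]
    intro i j hij
    filter_upwards [((hf i).sub (hf j)).eventually_ne (c := 0) (sub_ne_zero.mpr (hf'.ne hij))]
      with k hk using sub_ne_zero.mp hk
  filter_upwards [hne] with k hk i j hij using not_imp_not.mp (hk i j) hij

section NormedFamily

variable {X : Type*} [NormedAddCommGroup X] [NormedSpace ℂ X] {H : ℝ → X →L[ℂ] X} {H₁ : X →L[ℂ] X}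

theorem tendsto_norm_sub_of_isBigO_sq
    (hderiv : (fun k : ℝ => H k - H 0 - (k : ℂ) • H₁) =O[𝓝 0] fun k => k ^ 2) :
    Tendsto (fun k => ‖H k - H 0‖) (𝓝 0) (𝓝 0) := by
  have hrem : Tendsto (fun k : ℝ => H k - H 0 - (k : ℂ) • H₁) (𝓝 0) (𝓝 0) :=
    hderiv.trans_tendsto (by simpa using (continuous_pow 2).tendsto (0 : ℝ))
  have hlin : Tendsto (fun k : ℝ => (k : ℂ) • H₁) (𝓝 0) (𝓝 0) := by
    have : Continuous fun k : ℝ => (k : ℂ) • H₁ := by fun_prop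
    simpa using this.tendsto 0
  simpa using (hrem.add hlin).norm

theorem eventually_half_mul_norm_le {Y : Submodule ℂ X} {γ : ℝ} (hγ : 0 < γ)
    (hgap : ∀ u ∈ Y, γ * ‖u‖ ≤ ‖H 0 u‖)
    (hH : Tendsto (fun k => ‖H k - H 0‖) (𝓝 0) (𝓝 0)) :
    ∀ᶠ k in 𝓝 0, ∀ u ∈ Y, γ / 2 * ‖u‖ ≤ ‖H k u‖ := by
  filter_upwards [hH.eventually_le_const (half_pos hγ)] with k hk u hu
  have hsub : ‖H k u - H 0 u‖ ≤ γ / 2 * ‖u‖ := (H k - H 0).le_of_opNorm_le hk u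
  linarith [hgap u hu, norm_le_norm_add_norm_sub' (H 0 u) (H k u), norm_sub_rev (H 0 u) (H k u)]

theorem isBigO_sq_apply_corrected_sub
    (hderiv : (fun k : ℝ => H k - H 0 - (k : ℂ) • H₁) =O[𝓝 0] fun k => k ^ 2)
    {φ w : X} {μ : ℝ} (hφ : H 0 φ = 0) (hw : H 0 w = (μ : ℂ) • φ - H₁ φ) :
    (fun k : ℝ => H k (φ + (k : ℂ) • w) - ((μ * k : ℝ) : ℂ) • (φ + (k : ℂ) • w))
      =O[𝓝 0] fun k => k ^ 2 := by
  have hsplit (k : ℝ) : H k (φ + (k : ℂ) • w) - ((μ * k : ℝ) : ℂ) • (φ + (k : ℂ) • w) =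
      (H k - H 0 - (k : ℂ) • H₁) (φ + (k : ℂ) • w) + (k : ℂ) ^ 2 • (H₁ w - (μ : ℂ) • w) := by
    simp only [sub_apply, smul_apply, map_add, map_smul, hφ, hw]
    push_cast
    module
  have hbounded : (fun k : ℝ => φ + (k : ℂ) • w) =O[𝓝 0] fun _ => (1 : ℝ) := by
    have : Continuous fun k : ℝ => φ + (k : ℂ) • w := by fun_prop
    exact (this.tendsto 0).isBigO_one ℝ
  have hfirst : (fun k : ℝ => (H k - H 0 - (k : ℂ) • H₁) (φ + (k : ℂ) • w))
      =O[𝓝 0] fun k => k ^ 2 := by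
    simpa using (isBigO_of_le _ fun k => by
      simpa using (H k - H 0 - (k : ℂ) • H₁).le_opNorm (φ + (k : ℂ) • w) :
        _ =O[𝓝 0] fun k : ℝ => ‖H k - H 0 - (k : ℂ) • H₁‖ * ‖φ + (k : ℂ) • w‖).trans
      (hderiv.norm_left.mul hbounded.norm_left)
  have hsecond : (fun k : ℝ => (k : ℂ) ^ 2 • (H₁ w - (μ : ℂ) • w)) =O[𝓝 0] fun k => k ^ 2 :=
    .of_bound ‖H₁ w - (μ : ℂ) • w‖ (.of_forall fun k => by simp [norm_smul, mul_comm])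
  simpa only [hsplit] using hfirst.add hsecond

end NormedFamily

section EigenvalueBranches

variable {X : Type*} [NormedAddCommGroup X] [InnerProductSpace ℂ X] [CompleteSpace X]
  {H : ℝ → X →L[ℂ] X} {H₁ : X →L[ℂ] X} {γ : ℝ}

theorem exists_eigenvalue_branch [FiniteDimensional ℂ (H 0).ker] (hH : ∀ k, IsSelfAdjoint (H k))
    (hderiv : (fun k : ℝ => H k - H 0 - (k : ℂ) • H₁) =O[𝓝 0] fun k => k ^ 2)
    (hγ : 0 < γ) (hgap : ∀ u ∈ (H 0).kerᗮ, γ * ‖u‖ ≤ ‖H 0 u‖)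
    {φ : X} {μ : ℝ} (hφ : H 0 φ = 0) (hφ0 : φ ≠ 0) (hμ : H₁ φ - (μ : ℂ) • φ ∈ (H 0).kerᗮ) :
    ∃ e : ℝ → ℝ, (fun k => e k - μ * k) =O[𝓝 0] (fun k => k ^ 2) ∧
      ∀ᶠ k in 𝓝 0, Module.End.HasEigenvalue (H k : X →ₗ[ℂ] X) (e k) := by
  obtain ⟨w, hw⟩ := exists_apply_eq_of_mem_orthogonal_ker (hH 0) hγ hgap
    (by simpa using neg_mem hμ : (μ : ℂ) • φ - H₁ φ ∈ (H 0).kerᗮ)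
  have hφw : Tendsto (fun k : ℝ => φ + (k : ℂ) • w) (𝓝 0) (𝓝 φ) := by
    have : Continuous fun k : ℝ => φ + (k : ℂ) • w := by fun_prop
    simpa using this.tendsto 0
  have hone : (fun _ => φ) =O[𝓝 0] fun k : ℝ => φ + (k : ℂ) • w :=
    ((isEquivalent_const_iff_tendsto hφ0).mpr hφw).symm.isBigO
  obtain ⟨C, hC⟩ := ((isBigO_sq_apply_corrected_sub hderiv hφ hw).norm_left.mul
    ((isBigO_const_const (1 : ℝ) hφ0 _).trans hone).norm_right).bound
  have hsmall : ∀ᶠ k : ℝ in 𝓝 0, |μ * k| + C * k ^ 2 < γ / 2 := by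
    have : Continuous fun k : ℝ => |μ * k| + C * k ^ 2 := by fun_prop
    exact this.tendsto 0 |>.eventually_lt_const (by simpa using half_pos hγ)
  have hex : ∀ᶠ k : ℝ in 𝓝 0, ∃ z : ℝ, |z - μ * k| ≤ C * k ^ 2 ∧
      Module.End.HasEigenvalue (H k : X →ₗ[ℂ] X) z := by
    filter_upwards [hC, hsmall, hφw.eventually_ne hφ0,
      eventually_half_mul_norm_le hγ hgap (tendsto_norm_sub_of_isBigO_sq hderiv)]
      with k hCk hk hne hgapk
    obtain ⟨z, hz, hzμ⟩ := exists_mem_spectrum_norm_sub_le (hH k) hne (μ := μ * k)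
      (ε := C * k ^ 2) (by simpa [mul_assoc] using hCk)
    have hzlt : ‖z‖ < γ / 2 := by
      have := norm_le_norm_sub_add z ((μ * k : ℝ) : ℂ)
      rw [Complex.norm_real, Real.norm_eq_abs] at this
      linarith
    have hzre := (hH k).mem_spectrum_eq_re hz
    have hev := hasEigenvalue_of_mem_spectrum_of_norm_lt (hH k) hgapk hz hzlt
    rw [hzre] at hev hzμ
    exact ⟨z.re, by rwa [← Complex.ofReal_sub, Complex.norm_real] at hzμ, hev⟩
  obtain ⟨e, he⟩ := hex.choice
  exact ⟨e, .of_bound C (he.mono fun k hk => by simpa using hk.1), he.mono fun k hk => hk.2⟩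

theorem eq_zero_of_hasEigenvalue_of_norm_lt {T : X →L[ℂ] X} (hT : IsSelfAdjoint T)
    (hgap : ∀ u ∈ T.kerᗮ, γ * ‖u‖ ≤ ‖T u‖) {E : ℂ}
    (hE : Module.End.HasEigenvalue (T : X →ₗ[ℂ] X) E) (hlt : ‖E‖ < γ) : E = 0 := by
  obtain ⟨v, hv⟩ := hE.exists_hasEigenvector
  by_contra hE0
  have hTv : T v = E • v := hv.apply_eq_smul
  have hmem : v ∈ T.kerᗮ := (Submodule.mem_orthogonal _ _).mpr fun u hu =>
    hT.isSymmetric.orthogonalFamily_eigenspaces (Ne.symm hE0)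
      ⟨u, by simpa using hu⟩ ⟨v, hv.1⟩
  have := hgap v hmem
  rw [hTv, norm_smul] at this
  exact (le_of_mul_le_mul_right this (norm_pos_iff.mpr hv.2)).not_gt hlt

theorem exists_eigenvalue_branches {ι : Type*} [Fintype ι] [Nonempty ι]
    (hH : ∀ k, IsSelfAdjoint (H k))
    (hderiv : (fun k : ℝ => H k - H 0 - (k : ℂ) • H₁) =O[𝓝 0] fun k => k ^ 2)
    (hγ : 0 < γ) (hgap : ∀ u ∈ (H 0).kerᗮ, γ * ‖u‖ ≤ ‖H 0 u‖)
    (hker : Module.finrank ℂ (H 0).ker = Fintype.card ι) {φ : ι → X} {μ : ι → ℝ}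
    (hφ : ∀ i, H 0 (φ i) = 0) (hφ0 : ∀ i, φ i ≠ 0) (hμ : Function.Injective μ)
    (hφμ : ∀ i, H₁ (φ i) - (μ i : ℂ) • φ i ∈ (H 0).kerᗮ) :
    ∃ e : ι → ℝ → ℝ, (∀ i, (fun k => e i k - μ i * k) =O[𝓝 0] fun k => k ^ 2) ∧
      ∃ η : ℝ, 0 < η ∧ ∀ᶠ k in 𝓝 0,
        {E : ℂ | ‖E‖ < η ∧ Module.End.HasEigenvalue (H k : X →ₗ[ℂ] X) E} =
          Set.range fun i => (e i k : ℂ) := by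
  have : FiniteDimensional ℂ (H 0).ker := Module.finite_of_finrank_pos (hker ▸ Fintype.card_pos)
  choose e he hev using fun i =>
    exists_eigenvalue_branch hH hderiv hγ hgap (hφ i) (hφ0 i) (hφμ i)
  have hderivAt (i : ι) := hasDerivAt_zero_of_isBigO_sq (he i)
  have he0 (i : ι) : e i 0 = 0 := apply_zero_of_isBigO_sq (he i)
  have hlt : ∀ᶠ k in 𝓝 0, ∀ i, ‖(e i k : ℂ)‖ < γ / 2 := eventually_all.mpr fun i => by
    have := (hderivAt i).continuousAt.norm.tendsto
    rw [he0, norm_zero] at this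
    simpa using this.eventually_lt_const (half_pos hγ)
  have hinj := eventually_nhdsWithin_iff.mp (eventually_injective_of_hasDerivAt hderivAt hμ)
  refine ⟨e, he, γ / 2, half_pos hγ, ?_⟩
  filter_upwards [hlt, eventually_all.mpr hev, hinj,
    eventually_half_mul_norm_le hγ hgap (tendsto_norm_sub_of_isBigO_sq hderiv)]
    with k hltk hevk hinjk hgapk
  rcases eq_or_ne k 0 with rfl | hk
  · refine Set.Subset.antisymm (fun E hE => ?_)
      (Set.range_subset_iff.mpr fun i => ⟨hltk i, hevk i⟩)
    have hE0 := eq_zero_of_hasEigenvalue_of_norm_lt (hH 0) hgap hE.2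
      (hE.1.trans (half_lt_self hγ))
    exact ⟨Classical.arbitrary ι, by simp [he0, hE0]⟩
  · exact setOf_eigenvalues_eq_range (hH k).isSymmetric hker hgapk
      (Complex.ofReal_injective.comp (hinjk hk)) hevk hltk

end EigenvalueBranches

section Crossing

variable {X : Type*} [NormedAddCommGroup X] [InnerProductSpace ℂ X]

theorem exists_mem_orthogonal_span_pair {T : X →ₗ[ℂ] X} (hT : T.IsSymmetric) {φ ψ : X}
    (hφ : ‖φ‖ = 1) (hψ : ‖ψ‖ = 1) (hφψ : inner ℂ φ ψ = 0) (hφT : inner ℂ φ (T φ) = 0)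
    (hψT : inner ℂ ψ (T ψ) = 0) {s : ℝ} (hs : s ≠ 0) (hsT : s ^ 2 = ‖inner ℂ ψ (T φ)‖ ^ 2) :
    ∃ w ∈ Submodule.span ℂ {φ, ψ}, w ≠ 0 ∧
      T w - (s : ℂ) • w ∈ (Submodule.span ℂ {φ, ψ})ᗮ := by
  set a := inner ℂ ψ (T φ) with ha
  have hsC : (s : ℂ) ≠ 0 := Complex.ofReal_ne_zero.mpr hs
  have hψφ : inner ℂ ψ φ = 0 := inner_eq_zero_symm.mp hφψ
  have hφφ : inner ℂ φ φ = 1 := by simp [inner_self_eq_norm_sq_to_K, hφ]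
  have hψψ : inner ℂ ψ ψ = 1 := by simp [inner_self_eq_norm_sq_to_K, hψ]
  have hconj : inner ℂ φ (T ψ) = (starRingEnd ℂ) a := by rw [ha, inner_conj_symm, hT]
  have hmul : a * (starRingEnd ℂ) a = (s : ℂ) ^ 2 := by
    rw [Complex.mul_conj, Complex.normSq_eq_norm_sq, ← hsT, Complex.ofReal_pow]
  refine ⟨φ + (a / s) • ψ, Submodule.mem_span_pair.mpr ⟨1, a / s, by simp⟩, fun h => ?_, ?_⟩
  · have h1 := congrArg (inner ℂ φ) h
    rw [inner_add_right, inner_smul_right, hφφ, hφψ, mul_zero, add_zero, inner_zero_right] at h1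
    exact one_ne_zero h1
  · simp only [Submodule.mem_orthogonal, Submodule.mem_span_pair]
    rintro _ ⟨α, β, rfl⟩
    simp only [map_add, map_smul, inner_add_left, inner_smul_left, inner_sub_right,
      inner_add_right, inner_smul_right, hφT, hψT, hφφ, hψψ, hφψ, hψφ, hconj, ← ha]
    field_simp
    linear_combination (starRingEnd ℂ) α * hmul

theorem eq_span_pair_of_finrank_eq_two {K : Submodule ℂ X} (hK : Module.finrank ℂ K = 2)
    {φ ψ : X} (hφ : φ ∈ K) (hψ : ψ ∈ K) (hφ0 : φ ≠ 0) (hψ0 : ψ ≠ 0)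
    (hφψ : inner ℂ φ ψ = 0) : K = Submodule.span ℂ {φ, ψ} := by
  have : FiniteDimensional ℂ K := Module.finite_of_finrank_pos (hK ▸ two_pos)
  have hli : LinearIndependent ℂ ![φ, ψ] := by
    refine linearIndependent_of_ne_zero_of_inner_eq_zero (by simp [Fin.forall_fin_two, *]) ?_
    simp [Pairwise, Fin.forall_fin_two, hφψ, inner_eq_zero_symm.mp hφψ]
  refine (Submodule.eq_of_le_of_finrank_eq ?_ ?_).symm
  · simpa [Submodule.span_le, Set.insert_subset_iff] using ⟨hφ, hψ⟩
  · rw [hK, ← Matrix.range_cons_cons_empty φ ψ ![], finrank_span_eq_card hli, Fintype.card_fin]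

variable [CompleteSpace X] {H : ℝ → X →L[ℂ] X} {H₁ : X →L[ℂ] X} {γ : ℝ}

theorem exists_crossing_eigenvalue_branches (hH : ∀ k, IsSelfAdjoint (H k))
    (hH₁ : IsSelfAdjoint H₁)
    (hderiv : (fun k : ℝ => H k - H 0 - (k : ℂ) • H₁) =O[𝓝 0] fun k => k ^ 2)
    (hγ : 0 < γ) (hgap : ∀ u ∈ (H 0).kerᗮ, γ * ‖u‖ ≤ ‖H 0 u‖)
    (hker : Module.finrank ℂ (H 0).ker = 2) {φ ψ : X} (hφ : H 0 φ = 0) (hψ : H 0 ψ = 0)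
    (hφ1 : ‖φ‖ = 1) (hψ1 : ‖ψ‖ = 1) (hφψ : inner ℂ φ ψ = 0) (hφH₁ : inner ℂ φ (H₁ φ) = 0)
    (hψH₁ : inner ℂ ψ (H₁ ψ) = 0) (hψφ : inner ℂ ψ (H₁ φ) ≠ 0) :
    ∃ (m : ℝ) (f g : ℝ → ℝ), 0 < m ∧ (fun k => f k - m * k) =O[𝓝 0] (fun k => k ^ 2) ∧
      (fun k => g k - -m * k) =O[𝓝 0] (fun k => k ^ 2) ∧
      ∃ η : ℝ, 0 < η ∧ ∀ᶠ k in 𝓝 0,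
        {E : ℂ | ‖E‖ < η ∧ Module.End.HasEigenvalue (H k : X →ₗ[ℂ] X) E} =
          {(f k : ℂ), (g k : ℂ)} := by
  set m := ‖inner ℂ ψ (H₁ φ)‖
  have hm : 0 < m := norm_pos_iff.mpr hψφ
  have hspan : (H 0).ker = Submodule.span ℂ {φ, ψ} :=
    eq_span_pair_of_finrank_eq_two hker (by simpa) (by simpa) (norm_pos_iff.mp (by simp [hφ1]))
      (norm_pos_iff.mp (by simp [hψ1])) hφψ
  have hsm (s : ℝ) := exists_mem_orthogonal_span_pair hH₁.isSymmetric hφ1 hψ1 hφψ hφH₁ hψH₁ (s := s)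
  simp only [← hspan] at hsm
  obtain ⟨v, hv, hv0, hvm⟩ := hsm m hm.ne' rfl
  obtain ⟨w, hw, hw0, hwm⟩ := hsm (-m) (neg_ne_zero.mpr hm.ne') (neg_sq m)
  obtain ⟨e, he, η, hη, hset⟩ := exists_eigenvalue_branches (ι := Fin 2) (φ := ![v, w])
    (μ := ![m, -m]) hH hderiv hγ hgap (by simpa using hker)
    (by simpa [Fin.forall_fin_two] using ⟨hv, hw⟩)
    (by simpa [Fin.forall_fin_two] using ⟨hv0, hw0⟩)
    (by
      have hne : m ≠ -m := by linarith
      intro i j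
      fin_cases i <;> fin_cases j <;> simp [hne, hne.symm])
    (Fin.forall_fin_two.mpr ⟨hvm, hwm⟩)
  refine ⟨m, e 0, e 1, hm, he 0, he 1, η, hη, hset.mono fun k hk => hk.trans ?_⟩
  ext E
  simp [Fin.exists_fin_two, eq_comm]

end Crossing

section EdgeHamiltonian

theorem hasSum_sub_shift {g : ℤ → ℂ} (hg : Summable g) : HasSum (fun n => g n - g (n - 1)) 0 := by
  have hshift : HasSum (fun n => g (n - 1)) (∑' n, g n) :=
    (Equiv.subRight (1 : ℤ)).hasSum_iff.mpr hg.hasSum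
  simpa using hg.hasSum.sub hshift

theorem conj_phase (k : ℝ) : starRingEnd ℂ (phase k) = phase (-k) := by
  simp [phase, ← Complex.exp_conj]

theorem phase_eq (k : ℝ) : phase k = (Real.cos k : ℂ) + (Real.sin k : ℂ) * Complex.I := by
  rw [phase, mul_comm, Complex.exp_mul_I, Complex.ofReal_cos, Complex.ofReal_sin]

theorem phase_zero : phase 0 = 1 := by simp [phase]

/-- The contribution of the bond between site `j` of cell `n` and site `i` of cell `n + 1` to a
sesquilinear form; linear in `u`, conjugate linear in `v`. -/
noncomputable def bondForm (p : HoppingParameters) (i j : Fin 6) (u v : EdgeSpace) (n : ℤ) : ℂ :=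
  p.cI n * (u (n + 1) i * starRingEnd ℂ (v n j))

theorem summable_bondForm (p : HoppingParameters) (i j : Fin 6) (u v : EdgeSpace) :
    Summable (bondForm p i j u v) := by
  have hu : Summable fun n : ℤ => ‖u (n + 1)‖ ^ 2 :=
    (Equiv.addRight (1 : ℤ)).summable_iff.mpr (hasSum_norm_sq u).summable
  refine .of_norm_bounded ((hu.add (hasSum_norm_sq v).summable).mul_left (p.bound / 2)) fun n => ?_
  rw [bondForm, norm_mul, norm_mul, RCLike.norm_conj, Complex.norm_real, Real.norm_eq_abs]
  calc |p.cI n| * (‖u (n + 1) i‖ * ‖v n j‖)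
      ≤ p.bound * (‖u (n + 1)‖ * ‖v n‖) := by
        gcongr
        exacts [p.bound_nonneg, p.abs_aI_le _, PiLp.norm_apply_le _ _, PiLp.norm_apply_le _ _]
    _ ≤ p.bound / 2 * (‖u (n + 1)‖ ^ 2 + ‖v n‖ ^ 2) := by
        nlinarith [mul_nonneg p.bound_nonneg (sq_nonneg (‖u (n + 1)‖ - ‖v n‖))]

theorem isSelfAdjoint_hamiltonianI (p : HoppingParameters) (k : ℝ) :
    IsSelfAdjoint (hamiltonianI p k) := by
  refine ContinuousLinearMap.isSelfAdjoint_iff_isSymmetric.mpr fun u v => ?_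
  rw [← sub_eq_zero]
  have hconj (i j : Fin 6) : Summable fun n => starRingEnd ℂ (bondForm p i j u v n) :=
    (summable_bondForm p i j u v).star
  have hsum := hasSum_sub_shift (((hconj 3 2).neg.sub ((hconj 0 5).mul_left (phase (-k)))).add
    ((summable_bondForm p 3 2 v u).add ((summable_bondForm p 0 5 v u).mul_left (phase k))))
  refine HasSum.unique ?_ hsum
  refine ((lp.hasSum_inner (𝕜 := ℂ) (hamiltonianI p k u) v).sub
    (lp.hasSum_inner (𝕜 := ℂ) u (hamiltonianI p k v))).congr_fun fun n => ?_
  simp only [bondForm, hamiltonianI_apply, hamActionI, PiLp.inner_apply, Fin.sum_univ_six,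
    RCLike.inner_apply, map_sub, map_mul, map_neg, Complex.conj_ofReal, conj_phase, neg_neg,
    sub_add_cancel, Complex.conj_conj, Matrix.cons_val]
  ring

/-- The derivative at `k = 0` of `k ↦ hamiltonianI p k`, which is a combination of values because
`hamiltonianI p k` is affine in `(cos k, sin k)`. -/
noncomputable def hamiltonianDeriv (p : HoppingParameters) : EdgeSpace →L[ℂ] EdgeSpace :=
  hamiltonianI p (Real.pi / 2) - (1 / 2 : ℂ) • (hamiltonianI p 0 + hamiltonianI p Real.pi)

theorem isSelfAdjoint_hamiltonianDeriv (p : HoppingParameters) :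
    IsSelfAdjoint (hamiltonianDeriv p) :=
  (isSelfAdjoint_hamiltonianI p _).sub
    ((show IsSelfAdjoint (1 / 2 : ℂ) by simp [isSelfAdjoint_iff]).smul
      ((isSelfAdjoint_hamiltonianI p _).add (isSelfAdjoint_hamiltonianI p _)))

theorem hamiltonianDeriv_apply (p : HoppingParameters) (u : EdgeSpace) (n : ℤ) :
    hamiltonianDeriv p u n =
      !₂[Complex.I * p.cI (n - 1) * u (n - 1) 5, -(Complex.I * p.dI n * u n 4), 0, 0,
        Complex.I * p.dI n * u n 1, -(Complex.I * p.cI n * u (n + 1) 0)] := by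
  change hamActionI p (Real.pi / 2) u n -
    (1 / 2 : ℂ) • (hamActionI p 0 u n + hamActionI p Real.pi u n) = _
  ext j
  fin_cases j <;> simp [hamActionI, phase_eq] <;> ring

theorem hamiltonianI_sub_eq (p : HoppingParameters) (k : ℝ) :
    hamiltonianI p k - hamiltonianI p 0 - (k : ℂ) • hamiltonianDeriv p =
      ((phase k - 1 - Complex.I * k).im : ℂ) • hamiltonianDeriv p +
        ((phase k - 1 - Complex.I * k).re : ℂ) •
          ((1 / 2 : ℂ) • (hamiltonianI p 0 - hamiltonianI p Real.pi)) := by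
  ext u n : 3
  change hamActionI p k u n - hamActionI p 0 u n - (k : ℂ) • hamiltonianDeriv p u n =
    ((phase k - 1 - Complex.I * k).im : ℂ) • hamiltonianDeriv p u n +
      ((phase k - 1 - Complex.I * k).re : ℂ) •
        ((1 / 2 : ℂ) • (hamActionI p 0 u n - hamActionI p Real.pi u n))
  rw [hamiltonianDeriv_apply]
  ext j
  fin_cases j <;> simp [hamActionI, phase_eq, -Complex.ofReal_sin, -Complex.ofReal_cos] <;> ring

theorem isBigO_hamiltonianI_sub (p : HoppingParameters) :
    (fun k : ℝ => hamiltonianI p k - hamiltonianI p 0 - (k : ℂ) • hamiltonianDeriv p)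
      =O[𝓝 0] fun k => k ^ 2 := by
  have hphase : ∀ᶠ k : ℝ in 𝓝 0, ‖phase k - 1 - Complex.I * k‖ ≤ 1 * ‖k ^ 2‖ := by
    filter_upwards [Metric.closedBall_mem_nhds (0 : ℝ) one_pos] with k hk
    have := Complex.norm_exp_sub_one_sub_id_le (x := Complex.I * k) (by simpa using hk)
    simpa [phase] using this
  have him := IsBigO.of_bound 1 (hphase.mono fun k hk => (Complex.norm_real _).le.trans
    ((Complex.abs_im_le_norm _).trans hk))
  have hre := IsBigO.of_bound 1 (hphase.mono fun k hk => (Complex.norm_real _).le.trans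
    ((Complex.abs_re_le_norm _).trans hk))
  simp only [hamiltonianI_sub_eq]
  simpa using (him.smul (isBigO_const_const (hamiltonianDeriv p) (one_ne_zero' ℝ) _)).add
    (hre.smul (isBigO_const_const _ (one_ne_zero' ℝ) _))

end EdgeHamiltonian

section Sublattices

/-- The six sites of one cell. -/
abbrev Cell : Type := EuclideanSpace ℂ (Fin 6)

/-- The operator on `EdgeSpace` applying the same linear map in every cell. -/
noncomputable def cellwise (L : Cell →ₗ[ℂ] Cell) : EdgeSpace →L[ℂ] EdgeSpace :=
  lp.mapCLM 2 (fun _ : ℤ => L.toContinuousLinearMap) (norm_nonneg L.toContinuousLinearMap)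
    fun _ => le_rfl

theorem cellwise_apply (L : Cell →ₗ[ℂ] Cell) (u : EdgeSpace) (n : ℤ) :
    cellwise L u n = L (u n) := rfl

/-- The restriction of the states of a cell to the sublattice of the sites `0`, `1`, `2`. -/
noncomputable def restrictCell : Cell →ₗ[ℂ] Cell where
  toFun x := !₂[x 0, x 1, x 2, 0, 0, 0]
  map_add' x y := by ext j; fin_cases j <;> simp
  map_smul' r x := by ext j; fin_cases j <;> simp

/-- The exchange of the two sublattices of a cell, a symmetry of `hamiltonianI p 0`. -/
noncomputable def swapCell : Cell →ₗ[ℂ] Cell where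
  toFun x := !₂[x 3, x 4, x 5, x 0, x 1, x 2]
  map_add' x y := by ext j; fin_cases j <;> simp
  map_smul' r x := by ext j; fin_cases j <;> simp

theorem restrictCell_apply (x : Cell) : restrictCell x = !₂[x 0, x 1, x 2, 0, 0, 0] := rfl

theorem swapCell_apply (x : Cell) : swapCell x = !₂[x 3, x 4, x 5, x 0, x 1, x 2] := rfl

theorem norm_cellwise_swapCell (u : EdgeSpace) : ‖cellwise swapCell u‖ = ‖u‖ := by
  have hcell (n : ℤ) : ‖cellwise swapCell u n‖ ^ 2 = ‖u n‖ ^ 2 := by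
    simp only [cellwise_apply, swapCell_apply, EuclideanSpace.norm_sq_eq, Fin.sum_univ_six,
      Matrix.cons_val]
    ring
  have hsum := hasSum_norm_sq (cellwise swapCell u)
  simp only [hcell] at hsum
  exact (pow_left_inj₀ (norm_nonneg _) (norm_nonneg _) two_ne_zero).mp
    (hsum.unique (hasSum_norm_sq u))

/-- The states living on the sites `0`, `1`, `2` of every cell. -/
def firstSublattice : Submodule ℂ EdgeSpace where
  carrier := {u | ∀ n : ℤ, u n 3 = 0 ∧ u n 4 = 0 ∧ u n 5 = 0}
  add_mem' hu hv n := by simp [hu n, hv n]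
  zero_mem' n := by simp
  smul_mem' r u hu n := by simp [hu n]

/-- The states living on the sites `3`, `4`, `5` of every cell. -/
def secondSublattice : Submodule ℂ EdgeSpace where
  carrier := {u | ∀ n : ℤ, u n 0 = 0 ∧ u n 1 = 0 ∧ u n 2 = 0}
  add_mem' hu hv n := by simp [hu n, hv n]
  zero_mem' n := by simp
  smul_mem' r u hu n := by simp [hu n]

variable {u v : EdgeSpace}

theorem isOrtho_firstSublattice_secondSublattice : firstSublattice ⟂ secondSublattice := by
  refine Submodule.isOrtho_iff_inner_eq.mpr fun u hu v hv =>
    (lp.hasSum_inner (𝕜 := ℂ) u v).unique ?_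
  convert! hasSum_zero using 2 with n
  simp [PiLp.inner_apply, Fin.sum_univ_six, hu n, hv n]

theorem cellwise_restrictCell_mem_firstSublattice (u : EdgeSpace) :
    cellwise restrictCell u ∈ firstSublattice := fun n => by
  simp [cellwise_apply, restrictCell_apply]

theorem cellwise_swapCell_mem_secondSublattice (hu : u ∈ firstSublattice) :
    cellwise swapCell u ∈ secondSublattice := fun n => by
  simpa [cellwise_apply, swapCell_apply] using hu n

theorem hamiltonianDeriv_mem_secondSublattice (p : HoppingParameters)
    (hu : u ∈ firstSublattice) : hamiltonianDeriv p u ∈ secondSublattice := fun n => by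
  simp [hamiltonianDeriv_apply, hu n, hu (n - 1)]

theorem hamiltonianDeriv_mem_firstSublattice (p : HoppingParameters)
    (hu : u ∈ secondSublattice) : hamiltonianDeriv p u ∈ firstSublattice := fun n => by
  simp [hamiltonianDeriv_apply, hu n, hu (n + 1)]

end Sublattices

section ZeroModes

/-- The equations that the values `x`, `y`, `z` of a zero-energy state at `k = 0` on the three sites
of one sublattice satisfy; they are the same for both sublattices. -/
structure ZeroMode (p : HoppingParameters) (x y z : ℤ → ℂ) : Prop where
  left : ∀ n, (p.bI n : ℂ) * x n + p.bI n * y n + p.cI (n - 1) * z (n - 1) = 0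
  center : ∀ n, (p.bI n : ℂ) * x n + p.dI n * y n + p.bI n * z n = 0
  right : ∀ n, (p.cI n : ℂ) * x (n + 1) + p.bI n * y n + p.bI n * z n = 0

variable {p : HoppingParameters} {u : EdgeSpace}

theorem zeroMode_zero (p : HoppingParameters) : ZeroMode p 0 0 0 :=
  ⟨by simp, by simp, by simp⟩

theorem hamiltonianI_zero_apply (p : HoppingParameters) (u : EdgeSpace) (n : ℤ) :
    hamiltonianI p 0 u n =
      -!₂[p.bI n * u n 3 + p.bI n * u n 4 + p.cI (n - 1) * u (n - 1) 5,
        p.bI n * u n 3 + p.dI n * u n 4 + p.bI n * u n 5,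
        p.cI n * u (n + 1) 3 + p.bI n * u n 4 + p.bI n * u n 5,
        p.bI n * u n 0 + p.bI n * u n 1 + p.cI (n - 1) * u (n - 1) 2,
        p.bI n * u n 0 + p.dI n * u n 1 + p.bI n * u n 2,
        p.cI n * u (n + 1) 0 + p.bI n * u n 1 + p.bI n * u n 2] := by
  ext j
  fin_cases j <;> simp [hamiltonianI_apply, hamActionI, phase_zero] <;> ring

theorem hamiltonianI_zero_eq_zero_iff : hamiltonianI p 0 u = 0 ↔
    ZeroMode p (fun n => u n 0) (fun n => u n 1) (fun n => u n 2) ∧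
      ZeroMode p (fun n => u n 3) (fun n => u n 4) (fun n => u n 5) := by
  constructor
  · intro h
    have hn (n : ℤ) (j : Fin 6) := congrArg (fun v : EdgeSpace => -v n j) h
    simp only [hamiltonianI_zero_apply, PiLp.neg_apply, neg_neg, lp.coeFn_zero, Pi.zero_apply,
      PiLp.zero_apply, neg_zero] at hn
    exact ⟨⟨(hn · 3), (hn · 4), (hn · 5)⟩, ⟨(hn · 0), (hn · 1), (hn · 2)⟩⟩
  · rintro ⟨hA, hB⟩
    refine lp.ext (funext fun n => ?_)
    rw [hamiltonianI_zero_apply, hA.left, hA.center, hA.right, hB.left, hB.center, hB.right]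
    ext j
    fin_cases j <;> simp

theorem hamiltonianI_zero_cellwise_swapCell (hu : hamiltonianI p 0 u = 0) :
    hamiltonianI p 0 (cellwise swapCell u) = 0 :=
  hamiltonianI_zero_eq_zero_iff.mpr (hamiltonianI_zero_eq_zero_iff.mp hu).symm

theorem hamiltonianI_zero_cellwise_restrictCell (hu : hamiltonianI p 0 u = 0) :
    hamiltonianI p 0 (cellwise restrictCell u) = 0 :=
  hamiltonianI_zero_eq_zero_iff.mpr ⟨(hamiltonianI_zero_eq_zero_iff.mp hu).1, zeroMode_zero p⟩

theorem exists_mem_firstSublattice_norm_eq_one (hu : hamiltonianI p 0 u = 0) (hu0 : u ≠ 0) :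
    ∃ φ ∈ firstSublattice, hamiltonianI p 0 φ = 0 ∧ ‖φ‖ = 1 := by
  obtain ⟨v, hv, hv0⟩ : ∃ v, hamiltonianI p 0 v = 0 ∧ cellwise restrictCell v ≠ 0 := by
    by_contra! h
    have hA (n : ℤ) (j : Fin 6) : restrictCell (u n) j = 0 := by
      rw [← cellwise_apply, h u hu]; rfl
    have hB (n : ℤ) (j : Fin 6) : restrictCell (swapCell (u n)) j = 0 := by
      rw [← cellwise_apply swapCell, ← cellwise_apply,
        h _ (hamiltonianI_zero_cellwise_swapCell hu)]
      rfl
    refine hu0 (lp.ext (funext fun n => PiLp.ext fun j => ?_))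
    fin_cases j
    exacts [hA n 0, hA n 1, hA n 2, hB n 0, hB n 1, hB n 2]
  exact ⟨(‖cellwise restrictCell v‖⁻¹ : ℂ) • cellwise restrictCell v,
    Submodule.smul_mem _ _ (cellwise_restrictCell_mem_firstSublattice v),
    by rw [map_smul, hamiltonianI_zero_cellwise_restrictCell hv, smul_zero],
    norm_smul_inv_norm hv0⟩

end ZeroModes

section Positivity

namespace HoppingParameters.Positive

variable {p : HoppingParameters}

theorem bI_pos (hp : p.Positive) (n : ℤ) : 0 < p.bI n := by
  unfold bI
  split_ifs
  exacts [hp.bPlus_pos, hp.bMinus_pos]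

theorem dI_pos (hp : p.Positive) (n : ℤ) : 0 < p.dI n := by
  unfold dI
  split_ifs
  exacts [hp.interPlus_pos, hp.interMinus_pos]

theorem cI_pos (hp : p.Positive) (n : ℤ) : 0 < p.cI n := by
  unfold cI aI
  split_ifs
  exacts [hp.interPlus_pos, hp.c_pos, hp.interMinus_pos]

end HoppingParameters.Positive

variable {p : HoppingParameters} {u : EdgeSpace}

-- Pair the three equations with `conj x`, `conj y` and `conj z` and take real parts.
theorem ZeroMode.re_add_re_eq {x y z : ℤ → ℂ} (h : ZeroMode p x y z) (n : ℤ) :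
    (p.cI n * (x (n + 1) * starRingEnd ℂ (z n))).re +
        (p.cI (n - 1) * (x n * starRingEnd ℂ (z (n - 1)))).re =
      p.dI n * ‖y n‖ ^ 2 - p.bI n * (‖x n‖ ^ 2 + ‖z n‖ ^ 2) := by
  have hl := congrArg (fun w => (w * starRingEnd ℂ (x n)).re) (h.left n)
  have hc := congrArg (fun w => (w * starRingEnd ℂ (y n)).re) (h.center n)
  have hr := congrArg (fun w => (w * starRingEnd ℂ (z n)).re) (h.right n)
  simp only [Complex.sq_norm, Complex.normSq_apply, Complex.add_re, Complex.add_im, Complex.mul_re,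
    Complex.mul_im, Complex.conj_re, Complex.conj_im, Complex.ofReal_re, Complex.ofReal_im,
    Complex.zero_re, Complex.zero_im] at hl hc hr ⊢
  linear_combination hl + hr - hc

theorem hasSum_energy (hu : u ∈ firstSublattice) (hHu : hamiltonianI p 0 u = 0) :
    HasSum (fun n => p.bI n * (‖u n 0‖ ^ 2 + ‖u n 2‖ ^ 2) + p.dI n * ‖u n 1‖ ^ 2)
      (2 * (inner ℂ (cellwise swapCell u) (hamiltonianDeriv p u)).im) := by
  have hinner := (Complex.hasSum_im
    (lp.hasSum_inner (𝕜 := ℂ) (cellwise swapCell u) (hamiltonianDeriv p u))).mul_left 2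
  have hbond := Complex.hasSum_re (hasSum_sub_shift (summable_bondForm p 0 2 u u))
  rw [← add_zero (2 * _)]
  refine (hinner.add hbond).congr_fun fun n => ?_
  have hcell : inner ℂ (cellwise swapCell u n) (hamiltonianDeriv p u n) =
      Complex.I * (((p.dI n * ‖u n 1‖ ^ 2 : ℝ) : ℂ) - bondForm p 0 2 u u n) := by
    rw [Complex.ofReal_mul, Complex.ofReal_pow, ← Complex.mul_conj']
    simp only [PiLp.inner_apply, Fin.sum_univ_six, cellwise_apply, swapCell_apply,
      hamiltonianDeriv_apply, RCLike.inner_apply, Matrix.cons_val, hu n, map_zero, mul_zero,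
      zero_mul, zero_add, bondForm]
    ring
  have hre : (bondForm p 0 2 u u n).re + (bondForm p 0 2 u u (n - 1)).re =
      p.dI n * ‖u n 1‖ ^ 2 - p.bI n * (‖u n 0‖ ^ 2 + ‖u n 2‖ ^ 2) := by
    simpa only [bondForm, sub_add_cancel] using
      (hamiltonianI_zero_eq_zero_iff.mp hHu).1.re_add_re_eq n
  rw [hcell, Complex.I_mul_im, Complex.sub_re, Complex.sub_re, Complex.ofReal_re]
  linarith

theorem inner_swap_hamiltonianDeriv_ne_zero (hp : p.Positive) (hu : u ∈ firstSublattice)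
    (hHu : hamiltonianI p 0 u = 0) (hu0 : u ≠ 0) :
    inner ℂ (cellwise swapCell u) (hamiltonianDeriv p u) ≠ 0 := by
  intro hzero
  have hsum := hasSum_energy hu hHu
  have hb := hp.bI_pos
  have hd := hp.dI_pos
  rw [hzero, Complex.zero_im, mul_zero, hasSum_zero_iff_of_nonneg fun n => by
    have := hb n
    have := hd n
    positivity] at hsum
  refine hu0 (lp.ext (funext fun n => ?_))
  have hn : p.bI n * (‖u n 0‖ ^ 2 + ‖u n 2‖ ^ 2) + p.dI n * ‖u n 1‖ ^ 2 = 0 := congrFun hsum n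
  have hbn := hb n
  have hdn := hd n
  rw [add_eq_zero_iff_of_nonneg (by positivity) (by positivity), mul_eq_zero_iff_left hbn.ne',
    mul_eq_zero_iff_left hdn.ne', add_eq_zero_iff_of_nonneg (by positivity) (by positivity)] at hn
  simp only [sq_eq_zero_iff, norm_eq_zero] at hn
  ext j
  fin_cases j
  exacts [hn.1.1, hn.2, hn.1.2, (hu n).1, (hu n).2.1, (hu n).2.2]

end Positivity

section BulkEstimate

/-- Around the cell `n` the coefficients are those of a homogeneous material with intracell
hopping `b` and intercell hopping `d`. -/
structure BulkAt (p : HoppingParameters) (b d : ℝ) (n : ℤ) : Prop where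
  bI_pred : p.bI (n - 1) = b
  bI_self : p.bI n = b
  bI_succ : p.bI (n + 1) = b
  dI_pred : p.dI (n - 1) = d
  dI_self : p.dI n = d
  dI_succ : p.dI (n + 1) = d
  cI_pred : p.cI (n - 1) = d
  cI_self : p.cI n = d

theorem bulkAt_of_one_le (p : HoppingParameters) {n : ℤ} (hn : 1 ≤ n) :
    BulkAt p p.bPlus (p.bPlus + p.deltaPlus) n := by
  constructor <;> simp only [HoppingParameters.bI, HoppingParameters.dI, HoppingParameters.cI,
    HoppingParameters.aI] <;> split_ifs <;> first | rfl | omega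

theorem bulkAt_of_le_neg_two (p : HoppingParameters) {n : ℤ} (hn : n ≤ -2) :
    BulkAt p p.bMinus (p.bMinus + p.deltaMinus) n := by
  constructor <;> simp only [HoppingParameters.bI, HoppingParameters.dI, HoppingParameters.cI,
    HoppingParameters.aI] <;> split_ifs <;> first | rfl | omega

/-- Minus the adjugate of the symbol of the homogeneous Hamiltonian at `k = 0`, as an operator on
the values in three consecutive cells. -/
noncomputable def bulkAdjugate (b d : ℂ) : Cell × Cell × Cell →ₗ[ℂ] Cell where
  toFun f := !₂[
    b * d * f.1 4 - d ^ 2 * f.1 5 + (d * b - b ^ 2) * f.2.1 3 - b ^ 2 * f.2.1 4 + b ^ 2 * f.2.1 5,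
    b * d * f.1 5 - b ^ 2 * f.2.1 3 + (b ^ 2 - d ^ 2) * f.2.1 4 - b ^ 2 * f.2.1 5 +
      b * d * f.2.2 3,
    b ^ 2 * f.2.1 3 - b ^ 2 * f.2.1 4 + (b * d - b ^ 2) * f.2.1 5 - d ^ 2 * f.2.2 3 +
      b * d * f.2.2 4,
    b * d * f.1 1 - d ^ 2 * f.1 2 + (d * b - b ^ 2) * f.2.1 0 - b ^ 2 * f.2.1 1 + b ^ 2 * f.2.1 2,
    b * d * f.1 2 - b ^ 2 * f.2.1 0 + (b ^ 2 - d ^ 2) * f.2.1 1 - b ^ 2 * f.2.1 2 +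
      b * d * f.2.2 0,
    b ^ 2 * f.2.1 0 - b ^ 2 * f.2.1 1 + (b * d - b ^ 2) * f.2.1 2 - d ^ 2 * f.2.2 0 +
      b * d * f.2.2 1]
  map_add' x y := by ext j; fin_cases j <;> simp <;> ring
  map_smul' r x := by ext j; fin_cases j <;> simp <;> ring

theorem BulkAt.smul_eq {p : HoppingParameters} {b d : ℝ} {n : ℤ} (h : BulkAt p b d n)
    (u : ℤ → Cell) :
    ((2 * b ^ 3 + d ^ 3 - b ^ 2 * d : ℝ) : ℂ) • u n =
      ((b ^ 2 * d : ℝ) : ℂ) • (u (n + 1) + u (n - 1)) + bulkAdjugate b d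
        (hamActionI p 0 u (n - 1), hamActionI p 0 u n, hamActionI p 0 u (n + 1)) := by
  ext j
  fin_cases j <;>
    simp [hamActionI, bulkAdjugate, phase_zero, h.bI_pred, h.bI_self, h.bI_succ, h.dI_pred,
      h.dI_self, h.dI_succ, h.cI_pred, h.cI_self] <;> ring

theorem norm_triple_le_sqrt {E : Type*} [SeminormedAddCommGroup E] (x y z : E) :
    ‖(x, y, z)‖ ≤ √(‖x‖ ^ 2 + ‖y‖ ^ 2 + ‖z‖ ^ 2) := by
  refine max_le ?_ (max_le ?_ ?_) <;> refine Real.le_sqrt_of_sq_le ?_ <;> dsimp only <;>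
    linarith [sq_nonneg ‖x‖, sq_nonneg ‖y‖, sq_nonneg ‖z‖]

theorem exists_norm_le_of_bulkAt {b d : ℝ} (hb : 0 < b) (hd : 0 < d) (hbd : d ≠ b) :
    ∃ ρ K : ℝ, 0 ≤ ρ ∧ ρ < 1 / 2 ∧ 0 ≤ K ∧
      ∀ (p : HoppingParameters) (u : ℤ → Cell) (n : ℤ), BulkAt p b d n →
        ‖u n‖ ≤ ρ * (‖u (n + 1)‖ + ‖u (n - 1)‖) + K * √(‖hamActionI p 0 u (n - 1)‖ ^ 2 +
          ‖hamActionI p 0 u n‖ ^ 2 + ‖hamActionI p 0 u (n + 1)‖ ^ 2) := by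
  set κ := 2 * b ^ 3 + d ^ 3 - b ^ 2 * d with hκ_def
  set β := b ^ 2 * d
  set N := ‖(bulkAdjugate b d).toContinuousLinearMap‖
  have hβ : 0 < β := by positivity
  have hβκ : 2 * β < κ := by
    have : 0 < (d - b) ^ 2 * (d + 2 * b) :=
      mul_pos (sq_pos_of_ne_zero (sub_ne_zero.mpr hbd)) (by positivity)
    linear_combination this
  have hκ : 0 < κ := by linarith
  refine ⟨β / κ, N / κ, by positivity, by rw [div_lt_iff₀ hκ]; linarith, by positivity,
    fun p u n hn => ?_⟩
  set f := (hamActionI p 0 u (n - 1), hamActionI p 0 u n, hamActionI p 0 u (n + 1))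
  have hκu : κ * ‖u n‖ ≤ β * (‖u (n + 1)‖ + ‖u (n - 1)‖) + N * ‖f‖ := calc
    κ * ‖u n‖ = ‖(κ : ℂ) • u n‖ := by
      rw [norm_smul, Complex.norm_real, Real.norm_of_nonneg hκ.le]
    _ ≤ ‖(β : ℂ) • (u (n + 1) + u (n - 1))‖ + ‖bulkAdjugate b d f‖ := by
      rw [hn.smul_eq]
      exact norm_add_le _ _
    _ ≤ β * (‖u (n + 1)‖ + ‖u (n - 1)‖) + N * ‖f‖ := by
      rw [norm_smul, Complex.norm_real, Real.norm_of_nonneg hβ.le]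
      gcongr
      exacts [norm_add_le _ _, (bulkAdjugate b d).toContinuousLinearMap.le_opNorm f]
  rw [div_mul_eq_mul_div, div_mul_eq_mul_div, ← add_div, le_div_iff₀ hκ, mul_comm]
  exact hκu.trans (by gcongr; exact norm_triple_le_sqrt _ _ _)

-- The weights `ρ`, `ρ` and `1 - 2 * ρ` sum to one, so convexity of the square gives
-- `α n ^ 2 ≤ ρ * (α (n + 1) ^ 2 + α (n - 1) ^ 2) + g n / (1 - 2 * ρ)`, which is then summed.
theorem mul_le_of_hasSum_sq_of_subsolution {α g : ℤ → ℝ} {A B ρ : ℝ}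
    (hα : HasSum (fun n => α n ^ 2) A) (hg : HasSum g B) (hα0 : ∀ n, 0 ≤ α n)
    (hg0 : ∀ n, 0 ≤ g n) (hρ0 : 0 ≤ ρ) (hρ : ρ < 1 / 2)
    (hle : ∀ n, α n ≤ ρ * (α (n + 1) + α (n - 1)) + √(g n)) : (1 - 2 * ρ) ^ 2 * A ≤ B := by
  set t := 1 - 2 * ρ with ht
  have ht0 : 0 < t := by linarith
  have hshift : HasSum (fun n => α (n - 1) ^ 2 + α n ^ 2 + α (n + 1) ^ 2) (3 * A) :=
    hasSum_three_shifts (f := fun n => α n ^ 2) hα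
  have hpoint (n : ℤ) :
      (t + t * ρ) * α n ^ 2 ≤ t * ρ * (α (n - 1) ^ 2 + α n ^ 2 + α (n + 1) ^ 2) + g n := by
    have hsq := mul_le_mul_of_nonneg_left (pow_le_pow_left₀ (hα0 n) (hle n) 2) ht0.le
    have hvar : 0 ≤ t * (ρ * (α (n + 1) - α (n - 1))) ^ 2 + ρ * (t * α (n + 1) - √(g n)) ^ 2 +
        ρ * (t * α (n - 1) - √(g n)) ^ 2 := by positivity
    have hsqrt := Real.sq_sqrt (hg0 n)
    rw [ht] at hsq hvar ⊢
    linear_combination hsq + hvar + hsqrt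
  have := hasSum_le hpoint (hα.mul_left _) ((hshift.mul_left _).add hg)
  rw [ht] at this ⊢
  linear_combination this

/-- The two cells adjacent to the interface. -/
noncomputable def interfaceCells : EdgeSpace →L[ℂ] Cell × Cell :=
  (lp.evalCLM ℂ (fun _ : ℤ => Cell) 2 (-1)).prod (lp.evalCLM ℂ (fun _ : ℤ => Cell) 2 0)

variable {p : HoppingParameters}

theorem exists_norm_le_away_from_interface (hp : p.Positive) (hplus : p.deltaPlus ≠ 0)
    (hminus : p.deltaMinus ≠ 0) :
    ∃ ρ K : ℝ, 0 ≤ ρ ∧ ρ < 1 / 2 ∧ 0 ≤ K ∧ ∀ (u : ℤ → Cell) (n : ℤ), n ∉ ({-1, 0} : Finset ℤ) →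
      ‖u n‖ ≤ ρ * (‖u (n + 1)‖ + ‖u (n - 1)‖) + K * √(‖hamActionI p 0 u (n - 1)‖ ^ 2 +
        ‖hamActionI p 0 u n‖ ^ 2 + ‖hamActionI p 0 u (n + 1)‖ ^ 2) := by
  obtain ⟨ρ₁, K₁, hρ₁, hρ₁', hK₁, h₁⟩ := exists_norm_le_of_bulkAt hp.bPlus_pos hp.interPlus_pos
    (by simpa using hplus)
  obtain ⟨ρ₂, K₂, -, hρ₂', -, h₂⟩ := exists_norm_le_of_bulkAt hp.bMinus_pos hp.interMinus_pos
    (by simpa using hminus)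
  refine ⟨max ρ₁ ρ₂, max K₁ K₂, le_max_of_le_left hρ₁, max_lt hρ₁' hρ₂', le_max_of_le_left hK₁,
    fun u n hn => ?_⟩
  simp only [Finset.mem_insert, Finset.mem_singleton, not_or] at hn
  rcases lt_or_ge n 0 with hneg | hpos
  · refine (h₂ p u n (bulkAt_of_le_neg_two p (by omega))).trans ?_
    gcongr
    exacts [le_max_right _ _, le_max_right _ _]
  · refine (h₁ p u n (bulkAt_of_one_le p (by omega))).trans ?_
    gcongr
    exacts [le_max_left _ _, le_max_left _ _]

theorem exists_norm_le_mul_add_interfaceCells (hp : p.Positive) (hplus : p.deltaPlus ≠ 0)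
    (hminus : p.deltaMinus ≠ 0) :
    ∃ C : ℝ, ∀ u : EdgeSpace, ‖u‖ ≤ C * (‖hamiltonianI p 0 u‖ + ‖interfaceCells u‖) := by
  obtain ⟨ρ, K, hρ0, hρ, hK, hbulk⟩ := exists_norm_le_away_from_interface hp hplus hminus
  have ht : 0 < 1 - 2 * ρ := by linarith
  refine ⟨2 * (K + 1) / (1 - 2 * ρ), fun u => ?_⟩
  set f := hamiltonianI p 0 u
  let χ : ℤ → ℝ := fun n => if n ∈ ({-1, 0} : Finset ℤ) then ‖u n‖ ^ 2 else 0
  have hχ : HasSum χ (‖u (-1)‖ ^ 2 + ‖u 0‖ ^ 2) := by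
    simpa [χ] using hasSum_sum_of_ne_finset_zero (f := χ) (s := {-1, 0}) fun n hn => if_neg hn
  have hχ0 (n : ℤ) : 0 ≤ χ n := by
    dsimp only [χ]
    positivity
  have hle (n : ℤ) : ‖u n‖ ≤ ρ * (‖u (n + 1)‖ + ‖u (n - 1)‖) +
      √(K ^ 2 * (‖f (n - 1)‖ ^ 2 + ‖f n‖ ^ 2 + ‖f (n + 1)‖ ^ 2) + χ n) := by
    by_cases hn : n ∈ ({-1, 0} : Finset ℤ)
    · refine le_add_of_nonneg_of_le (by positivity) (Real.le_sqrt_of_sq_le ?_)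
      rw [show χ n = ‖u n‖ ^ 2 from if_pos hn]
      exact le_add_of_nonneg_left (by positivity)
    · rw [show χ n = 0 from if_neg hn, add_zero, Real.sqrt_mul (sq_nonneg K), Real.sqrt_sq hK]
      exact hbulk u n hn
  have hsum := mul_le_of_hasSum_sq_of_subsolution (hasSum_norm_sq u)
    (((hasSum_norm_sq_shifts f).mul_left (K ^ 2)).add hχ) (fun n => norm_nonneg _)
    (fun n => add_nonneg (by positivity) (hχ0 n)) hρ0 hρ hle
  have hfst : ‖u (-1)‖ ^ 2 ≤ ‖interfaceCells u‖ ^ 2 := by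
    gcongr
    exact norm_fst_le (interfaceCells u)
  have hsnd : ‖u 0‖ ^ 2 ≤ ‖interfaceCells u‖ ^ 2 := by
    gcongr
    exact norm_snd_le (interfaceCells u)
  have hsq : ((1 - 2 * ρ) * ‖u‖) ^ 2 ≤ (2 * (K + 1) * (‖f‖ + ‖interfaceCells u‖)) ^ 2 := by
    have : 0 ≤ K ^ 2 * ‖f‖ ^ 2 + (8 * K + 4) * ‖f‖ ^ 2 +
      (4 * K ^ 2 + 8 * K + 2) * ‖interfaceCells u‖ ^ 2 +
        8 * (K + 1) ^ 2 * ‖f‖ * ‖interfaceCells u‖ := by positivity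
    linear_combination hsum + hfst + hsnd + this
  rw [div_mul_eq_mul_div, le_div_iff₀ ht, mul_comm]
  exact (abs_le_of_sq_le_sq' hsq (by positivity)).2

end BulkEstimate

section GaplessBulk

theorem eq_of_tendsto_cofinite_of_succ_eq {X : Type*} [TopologicalSpace X] [T2Space X] {f : ℤ → X}
    {a : X} (hf : Tendsto f cofinite (𝓝 a)) {m : ℤ} (hsucc : ∀ n ≥ m, f (n + 1) = f n) :
    f m = a := by
  have hconst : ∀ n ≥ m, f n = f m := fun n hn =>
    Int.leInduction rfl (fun n hn ih => (hsucc n hn).trans ih) n hn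
  have hatTop : Tendsto f atTop (𝓝 a) := hf.mono_left (Int.cofinite_eq ▸ le_sup_right)
  exact tendsto_nhds_unique (tendsto_const_nhds.congr' <|
    (eventually_ge_atTop m).mono fun n hn => (hconst n hn).symm) hatTop

theorem eq_of_tendsto_cofinite_of_pred_eq {X : Type*} [TopologicalSpace X] [T2Space X] {f : ℤ → X}
    {a : X} (hf : Tendsto f cofinite (𝓝 a)) {m : ℤ} (hpred : ∀ n ≤ m, f (n - 1) = f n) :
    f m = a := by
  have hneg := eq_of_tendsto_cofinite_of_succ_eq (m := -m) (f := fun n => f (-n))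
    (hf.comp neg_injective.tendsto_cofinite) fun n hn => by
      rw [neg_add']
      exact hpred (-n) (by omega)
  rwa [neg_neg] at hneg

variable {p : HoppingParameters} {x y z : ℤ → ℂ}

theorem HoppingParameters.Positive.ofReal_bI_ne_zero (hp : p.Positive) (n : ℤ) :
    (p.bI n : ℂ) ≠ 0 :=
  Complex.ofReal_ne_zero.mpr (hp.bI_pos n).ne'

theorem HoppingParameters.Positive.ofReal_cI_ne_zero (hp : p.Positive) (n : ℤ) :
    (p.cI n : ℂ) ≠ 0 :=
  Complex.ofReal_ne_zero.mpr (hp.cI_pos n).ne'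

namespace ZeroMode

theorem middle_eq_zero (hp : p.Positive) (h : ZeroMode p x y z) {n : ℤ} (hx : x (n + 1) = 0)
    (hz : z n = 0) : y n = 0 := by
  simpa [hx, hz, hp.ofReal_bI_ne_zero n] using h.right n

theorem bond_succ_eq_zero (hp : p.Positive) (h : ZeroMode p x y z) {n : ℤ} (hx : x (n + 1) = 0)
    (hz : z n = 0) : x (n + 1 + 1) = 0 ∧ z (n + 1) = 0 := by
  have hy : y (n + 1) = 0 := by
    simpa [hx, hz, hp.ofReal_bI_ne_zero (n + 1)] using h.left (n + 1)
  have hz' : z (n + 1) = 0 := by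
    simpa [hx, hy, hp.ofReal_bI_ne_zero (n + 1)] using h.center (n + 1)
  exact ⟨by simpa [hy, hz', hp.ofReal_cI_ne_zero (n + 1)] using h.right (n + 1), hz'⟩

theorem bond_pred_eq_zero (hp : p.Positive) (h : ZeroMode p x y z) {n : ℤ} (hx : x (n + 1) = 0)
    (hz : z n = 0) : x n = 0 ∧ z (n - 1) = 0 := by
  have hy : y n = 0 := h.middle_eq_zero hp hx hz
  have hx' : x n = 0 := by simpa [hz, hy, hp.ofReal_bI_ne_zero n] using h.center n
  exact ⟨hx', by simpa [hx', hy, hp.ofReal_cI_ne_zero (n - 1)] using h.left n⟩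

/- The zero-energy equations are a recursion in both directions for the pair `(x (n + 1), z n)`
of amplitudes at the two ends of a bond between cells. -/
theorem eq_zero_of_bond (hp : p.Positive) (h : ZeroMode p x y z) {m : ℤ} (hx : x (m + 1) = 0)
    (hz : z m = 0) : x = 0 ∧ y = 0 ∧ z = 0 := by
  have hbond (n : ℤ) : x (n + 1) = 0 ∧ z n = 0 := by
    induction n using Int.inductionOn' (b := m) with
    | zero => exact ⟨hx, hz⟩
    | succ n _ ih => exact h.bond_succ_eq_zero hp ih.1 ih.2
    | pred n _ ih => simpa only [sub_add_cancel] using h.bond_pred_eq_zero hp ih.1 ih.2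
  refine ⟨funext fun n => ?_, funext fun n => h.middle_eq_zero hp (hbond n).1 (hbond n).2,
    funext fun n => (hbond n).2⟩
  simpa only [sub_add_cancel, Pi.zero_apply] using (hbond (n - 1)).1

theorem left_succ_eq (hp : p.Positive) (h : ZeroMode p x y z) {n : ℤ} (hd : p.dI n = p.bI n)
    (hc : p.cI n = p.bI n) : x (n + 1) = x n := by
  have hcenter := h.center n
  have hright := h.right n
  rw [hd] at hcenter
  rw [hc] at hright
  exact mul_left_cancel₀ (hp.ofReal_bI_ne_zero n) (by linear_combination hright - hcenter)

theorem right_pred_eq (hp : p.Positive) (h : ZeroMode p x y z) {n : ℤ} (hd : p.dI n = p.bI n)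
    (hc : p.cI (n - 1) = p.bI n) : z (n - 1) = z n := by
  have hcenter := h.center n
  have hleft := h.left n
  rw [hd] at hcenter
  rw [hc] at hleft
  exact mul_left_cancel₀ (hp.ofReal_bI_ne_zero n) (by linear_combination hleft - hcenter)

theorem eq_zero_of_deltaPlus_eq_zero (hp : p.Positive) (h : ZeroMode p x y z)
    (hx : Tendsto x cofinite (𝓝 0)) (hz : Tendsto z cofinite (𝓝 0)) (hδ : p.deltaPlus = 0) :
    x = 0 ∧ y = 0 ∧ z = 0 := by
  have hd {n : ℤ} (hn : 0 ≤ n) : p.dI n = p.bI n := by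
    simp [HoppingParameters.dI, HoppingParameters.bI, hn, hδ]
  have hc {n m : ℤ} (hn : 0 ≤ n) (hm : 0 ≤ m) : p.cI n = p.bI m := by
    simp [HoppingParameters.cI, HoppingParameters.aI, HoppingParameters.bI, hn, hm, hδ]
  have hx1 : x 1 = 0 := eq_of_tendsto_cofinite_of_succ_eq hx fun n hn =>
    h.left_succ_eq hp (hd (by omega)) (hc (by omega) (by omega))
  have hz0 : z 0 = 0 := eq_of_tendsto_cofinite_of_succ_eq hz fun n hn => by
    simpa only [add_sub_cancel_right] using
      (h.right_pred_eq hp (hd (n := n + 1) (by omega)) (hc (by omega) (by omega))).symm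
  exact h.eq_zero_of_bond hp (m := 0) hx1 hz0

theorem eq_zero_of_deltaMinus_eq_zero (hp : p.Positive) (h : ZeroMode p x y z)
    (hx : Tendsto x cofinite (𝓝 0)) (hz : Tendsto z cofinite (𝓝 0)) (hδ : p.deltaMinus = 0) :
    x = 0 ∧ y = 0 ∧ z = 0 := by
  have hd {n : ℤ} (hn : n ≤ -1) : p.dI n = p.bI n := by
    simp [HoppingParameters.dI, HoppingParameters.bI, show ¬ 0 ≤ n by omega, hδ]
  have hc {n m : ℤ} (hn : n ≤ -2) (hm : m ≤ -1) : p.cI n = p.bI m := by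
    simp [HoppingParameters.cI, HoppingParameters.aI, HoppingParameters.bI,
      show ¬ 0 ≤ n by omega, show n + 1 ≠ 0 by omega, show ¬ 0 ≤ m by omega, hδ]
  have hx1 : x (-1) = 0 := eq_of_tendsto_cofinite_of_pred_eq hx fun n hn => by
    simpa only [sub_add_cancel] using
      (h.left_succ_eq hp (hd (n := n - 1) (by omega)) (hc (by omega) (by omega))).symm
  have hz2 : z (-2) = 0 := eq_of_tendsto_cofinite_of_pred_eq hz fun n hn =>
    h.right_pred_eq hp (hd (by omega)) (hc (by omega) (by omega))
  exact h.eq_zero_of_bond hp (m := -2) (by simpa using hx1) hz2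

end ZeroMode

theorem tendsto_apply_cofinite (u : EdgeSpace) (j : Fin 6) :
    Tendsto (fun n : ℤ => u n j) cofinite (𝓝 0) :=
  squeeze_zero_norm (fun n => PiLp.norm_apply_le (u n) j) <| by
    simpa using (hasSum_norm_sq u).summable.tendsto_cofinite_zero.sqrt

theorem hamiltonianI_zero_injective_of_gapless (hp : p.Positive)
    (hδ : p.deltaPlus = 0 ∨ p.deltaMinus = 0) : Function.Injective (hamiltonianI p 0) := by
  refine (injective_iff_map_eq_zero _).mpr fun u hu => ?_
  have hvanish {x y z : ℤ → ℂ} (h : ZeroMode p x y z) (hx : Tendsto x cofinite (𝓝 0))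
      (hz : Tendsto z cofinite (𝓝 0)) : x = 0 ∧ y = 0 ∧ z = 0 :=
    hδ.elim (h.eq_zero_of_deltaPlus_eq_zero hp hx hz) (h.eq_zero_of_deltaMinus_eq_zero hp hx hz)
  obtain ⟨hA, hB⟩ := hamiltonianI_zero_eq_zero_iff.mp hu
  obtain ⟨h0, h1, h2⟩ := hvanish hA (tendsto_apply_cofinite u 0) (tendsto_apply_cofinite u 2)
  obtain ⟨h3, h4, h5⟩ := hvanish hB (tendsto_apply_cofinite u 3) (tendsto_apply_cofinite u 5)
  refine lp.ext (funext fun n => PiLp.ext fun j => ?_)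
  fin_cases j
  exacts [congrFun h0 n, congrFun h1 n, congrFun h2 n, congrFun h3 n, congrFun h4 n, congrFun h5 n]

end GaplessBulk

section InterfaceCrossing

theorem exists_mul_norm_le_of_mem_orthogonal_ker {𝕜 E F W : Type*} [RCLike 𝕜]
    [NormedAddCommGroup E] [InnerProductSpace 𝕜 E] [CompleteSpace E]
    [NormedAddCommGroup F] [NormedSpace 𝕜 F] [CompleteSpace F]
    [NormedAddCommGroup W] [NormedSpace 𝕜 W] [FiniteDimensional 𝕜 W]
    {T : E →L[𝕜] F} {R : E →L[𝕜] W} {C : ℝ} (hC : ∀ u, ‖u‖ ≤ C * (‖T u‖ + ‖R u‖)) :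
    ∃ g : ℝ, 0 < g ∧ ∀ u ∈ T.kerᗮ, g * ‖u‖ ≤ ‖T u‖ := by
  have hinj : Function.Injective (T ∘L T.kerᗮ.subtypeL) :=
    (injective_iff_map_eq_zero _).mpr fun u hu =>
      Subtype.ext (Submodule.disjoint_def.mp T.ker.orthogonal_disjoint u hu u.2)
  obtain ⟨g, hg, hbound⟩ := exists_mul_norm_le_of_injective_of_finiteDimensional
    (R := R ∘L T.kerᗮ.subtypeL) (fun u => hC u) hinj
  exact ⟨g, hg, fun u hu => hbound ⟨u, hu⟩⟩

theorem exists_crossing_hamiltonianI_branches {p : HoppingParameters} (hp : p.Positive)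
    (hker : Module.finrank ℂ (hamiltonianI p 0).ker = 2) :
    ∃ (m : ℝ) (f g : ℝ → ℝ), 0 < m ∧
      (fun k => f k - m * k) =O[𝓝 0] (fun k => k ^ 2) ∧
      (fun k => g k - -m * k) =O[𝓝 0] (fun k => k ^ 2) ∧
      ∃ η : ℝ, 0 < η ∧ ∀ᶠ k : ℝ in 𝓝 0,
        {E : ℂ | ‖E‖ < η ∧
          Module.End.HasEigenvalue (hamiltonianI p k : EdgeSpace →ₗ[ℂ] EdgeSpace) E} =
            {(f k : ℂ), (g k : ℂ)} := by
  have : Nontrivial (hamiltonianI p 0).ker := Module.nontrivial_of_finrank_pos (R := ℂ) (by omega)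
  obtain ⟨u, hu, hu0⟩ :=
    Submodule.exists_mem_ne_zero_of_ne_bot (Submodule.nontrivial_iff_ne_bot.mp this)
  have hgapless : ¬ (p.deltaPlus = 0 ∨ p.deltaMinus = 0) := fun hδ =>
    hu0 ((injective_iff_map_eq_zero _).mp (hamiltonianI_zero_injective_of_gapless hp hδ) u hu)
  obtain ⟨hplus, hminus⟩ := not_or.mp hgapless
  obtain ⟨C, hC⟩ := exists_norm_le_mul_add_interfaceCells hp hplus hminus
  obtain ⟨γ, hγ, hgap⟩ := exists_mul_norm_le_of_mem_orthogonal_ker hC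
  obtain ⟨φ, hφmem, hφ, hφ1⟩ := exists_mem_firstSublattice_norm_eq_one hu hu0
  have hψmem := cellwise_swapCell_mem_secondSublattice hφmem
  have hortho := Submodule.isOrtho_iff_inner_eq.mp isOrtho_firstSublattice_secondSublattice
  refine exists_crossing_eigenvalue_branches (isSelfAdjoint_hamiltonianI p)
    (isSelfAdjoint_hamiltonianDeriv p) (isBigO_hamiltonianI_sub p) hγ hgap hker
    hφ (hamiltonianI_zero_cellwise_swapCell hφ) hφ1 ((norm_cellwise_swapCell φ).trans hφ1)
    (hortho φ hφmem _ hψmem) (hortho φ hφmem _ (hamiltonianDeriv_mem_secondSublattice p hφmem))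
    ?_ (inner_swap_hamiltonianDeriv_ne_zero hp hφmem hφ (norm_ne_zero_iff.mp (hφ1 ▸ one_ne_zero)))
  exact inner_eq_zero_symm.mp (hortho _ (hamiltonianDeriv_mem_firstSublattice p hψmem) _ hψmem)

end InterfaceCrossing

section SortedBranches

variable {f g : ℝ → ℝ} {m : ℝ}

theorem eventually_sign_sub_eq_sign (hm : 0 < m)
    (hf : (fun k => f k - m * k) =O[𝓝 0] fun k => k ^ 2)
    (hg : (fun k => g k - -m * k) =O[𝓝 0] fun k => k ^ 2) :
    ∀ᶠ k in 𝓝 0, SignType.sign (f k - g k) = SignType.sign k := by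
  have hdiff : (fun k => (f - g) k - (m + m) * k) =O[𝓝 0] fun k => k ^ 2 :=
    (hf.sub hg).congr_left fun k => by simp only [Pi.sub_apply]; ring
  have hderiv : 0 < deriv (f - g) 0 := by
    rw [(hasDerivAt_zero_of_isBigO_sq hdiff).deriv]
    positivity
  simpa using eventually_nhdsWithin_sign_eq_of_deriv_pos hderiv
    (apply_zero_of_isBigO_sq hdiff)

theorem isBigO_ite_nonneg_sub_mul_abs (hf : (fun k => f k - m * k) =O[𝓝 0] fun k => k ^ 2)
    (hg : (fun k => g k - -m * k) =O[𝓝 0] fun k => k ^ 2) :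
    (fun k => (if 0 ≤ k then f k else g k) - m * |k|) =O[𝓝 0] fun k => k ^ 2 := by
  refine (IsBigO.of_norm_le fun k => ?_).trans (hf.norm_left.add hg.norm_left)
  split_ifs with hk
  · rw [abs_of_nonneg hk]
    exact le_add_of_nonneg_right (norm_nonneg _)
  · rw [abs_of_neg (not_le.mp hk), mul_neg, ← neg_mul]
    exact le_add_of_nonneg_left (norm_nonneg _)

theorem ite_nonneg_lt_ite_nonneg {k : ℝ} (hk : k ≠ 0)
    (hsign : SignType.sign (f k - g k) = SignType.sign k) :
    (if 0 ≤ k then g k else f k) < if 0 ≤ k then f k else g k := by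
  rcases hk.lt_or_gt with hneg | hpos
  · rw [sign_neg hneg, sign_eq_neg_one_iff, sub_neg] at hsign
    rwa [if_neg hneg.not_ge, if_neg hneg.not_ge]
  · rw [sign_pos hpos, sign_eq_one_iff, sub_pos] at hsign
    rwa [if_pos hpos.le, if_pos hpos.le]

end SortedBranches

theorem mainTheorem3 (p : HoppingParameters) (hp : p.Positive)
    (hzero : Module.finrank ℂ
      (Module.End.eigenspace (hamiltonianI p 0 : EdgeSpace →ₗ[ℂ] EdgeSpace) 0) = 2) :
    ∃ (E₁ : ℝ) (Eminus Eplus : ℝ → ℝ), 0 < E₁ ∧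
      -- for small `k`, the point spectrum near zero consists of the two branches
      (∃ η : ℝ, 0 < η ∧ ∃ k₀ : ℝ, 0 < k₀ ∧ ∀ k : ℝ, |k| < k₀ →
        {E : ℂ | ‖E‖ < η ∧
          Module.End.HasEigenvalue (hamiltonianI p k : EdgeSpace →ₗ[ℂ] EdgeSpace) E}
            = {(Eminus k : ℂ), (Eplus k : ℂ)} ∧
        (k ≠ 0 → Eminus k < Eplus k)) ∧
      -- the asymptotic expansions
      (fun k : ℝ => Eplus k - E₁ * |k|) =O[𝓝 0] (fun k : ℝ => k ^ 2) ∧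
      (fun k : ℝ => Eminus k - (-E₁ * |k|)) =O[𝓝 0] (fun k : ℝ => k ^ 2) ∧
      -- the energy curves through the crossing meet at zero energy with slopes `E₁` and `-E₁`
      Eminus 0 = 0 ∧ Eplus 0 = 0 ∧
      HasDerivAt (fun k : ℝ => if 0 ≤ k then Eplus k else Eminus k) E₁ 0 ∧
      HasDerivAt (fun k : ℝ => if 0 ≤ k then Eminus k else Eplus k) (-E₁) 0 := by
  obtain ⟨m, f, g, hm, hf, hg, η, hη, hspec⟩ := exists_crossing_hamiltonianI_branches hp <| by
    rwa [Module.End.eigenspace_zero] at hzero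
  have hf' : (fun k => f k - - -m * k) =O[𝓝 0] fun k => k ^ 2 := by simpa only [neg_neg] using hf
  obtain ⟨k₀, hk₀, hnear⟩ := Metric.eventually_nhds_iff.mp
    (hspec.and (eventually_sign_sub_eq_sign hm hf hg))
  refine ⟨m, fun k => if 0 ≤ k then g k else f k, fun k => if 0 ≤ k then f k else g k, hm,
    ⟨η, hη, k₀, hk₀, fun k hk => ?_⟩, isBigO_ite_nonneg_sub_mul_abs hf hg,
    isBigO_ite_nonneg_sub_mul_abs hg hf', ?_, ?_, ?_, ?_⟩
  · obtain ⟨heigen, hsign⟩ := hnear (by simpa using hk)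
    refine ⟨heigen.trans ?_, fun hk0 => ite_nonneg_lt_ite_nonneg hk0 hsign⟩
    dsimp only
    split_ifs
    exacts [Set.pair_comm _ _, rfl]
  · simpa using apply_zero_of_isBigO_sq hg
  · simpa using apply_zero_of_isBigO_sq hf
  · exact (hasDerivAt_zero_of_isBigO_sq hf).congr_of_eventuallyEq <|
      .of_forall fun k => by dsimp only; split_ifs <;> rfl
  · exact (hasDerivAt_zero_of_isBigO_sq hg).congr_of_eventuallyEq <|
      .of_forall fun k => by dsimp only; split_ifs <;> rfl
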